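/- An update is a pair $(a,\Delta)\in[n]\times\mathbb Z$, and a stream is a finite sequence of updates. Let $g:([n]\times\mathbb Z)^*\to\mathbb R$, and let $\mathcal S$ be a set of admissible streams (for instance all streams, or all insertion-only streams). Write $x\in(1\pm\varepsilon)y$ for $|x-y|\le\varepsilon|y|$. A *streaming algorithm* is a randomized machine with finitely many memory contents. After each update it uses fresh coins to choose its next memory content and to return a real estimate; its *space* is the number of bits needed to encode its memory contents between updates. An execution on $u_1,\dots,u_m$ with estimates $z_1,\dots,z_m$ is *$\varepsilon$-accurate* if $z_i\in(1\pm\varepsilon)\,g(u_1,\dots,u_i)$ for all $i\in\{1,\dots,m\}$. The *flip number* $\lambda_{\varepsilon,m}(g)$ is the largest $k$ for which there are a stream $u\in\mathcal S$ of length $m$ and times $0\le t_0<t_1<\dots<t_k\le m$ with $g(u_1,\dots,u_{t_{j+1}})\notin(1\pm\varepsilon)\,g(u_1,\dots,u_{t_j})$ for all $0\le j<k$. **Theorem.** For every $c\in\mathbb N$ there is a constant $C>0$ depending only on $c$ such that the following holds. Let $m\ge1$, $n\le m^c$, $0<\alpha\le1$, $0<\delta\le\frac12$, let $g$ and $\mathcal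 S$ be as above, and let $L\ge1$ be an integer. Let $\mathcal A$ be a streaming algorithm that uses at most $L$ bits of space, such that * (oblivious accuracy) on every fixed stream of length $m$ in $\mathcal S$, the execution of $\mathcal A$ is $\frac{\alpha}{10}$-accurate with probability at least $\frac{9}{10}$; * all estimates that $\mathcal A$ can return on streams of length $m$ in $\mathcal S$ lie in $[-n^c,-n^{-c}]\cup\{0\}\cup[n^{-c},n^c]$. Then there is a streaming algorithm $\mathcal B$ that is adversarially robust in the following sense: for every randomized adversary that chooses each update $u_i$ as a function of $u_1,z_1,\dots,u_{i-1},z_{i-1}$ and its own coins, where $z_1,\dots,z_m$ are the estimates returned by $\mathcal B$, with probability at least $1-\delta$ either the resulting stream $(u_1,\dots,u_m)$ is not in $\mathcal S$ or the execution of $\mathcal B$ is $\alpha$-accurate; and the space of $\mathcal B$ is at most $$C\cdot L\cdot\sqrt{\max\{1,\lambda_{\frac{\alpha}{10},m}(g)\}\cdot\log\tfrac1\delta}\cdot\log\frac{m}{\alpha\delta}$$ bits. -/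

import Mathlib

/-- A stream update `(a, Δ)`: an element `a` of a domain of size `n` together with an integer
weight `Δ`. -/
abbrev Update (n : ℕ) : Type := Fin n × ℤ

/-- A stream (or a prefix of one), earliest update first. -/
abbrev UpdateStream (n : ℕ) : Type := List (Update n)

/-- The record of an execution: in order of time, every update with the estimate that was returned
after it. -/
abbrev Transcript (n : ℕ) : Type := List (Update n × ℝ)

namespace Transcript

/-- The stream of updates that occurs in a transcript. -/
def stream {n : ℕ} (h : Transcript n) : UpdateStream n := h.map Prod.fst

/-- At every time step `i` the returned estimate `z` satisfies `z ∈ (1 ± α) · g(u₁, …, uᵢ)`, where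
`u₁, …, uᵢ` are the updates up to and including that step. -/
def Accurate {n : ℕ} (g : UpdateStream n → ℝ) (α : ℝ) (h : Transcript n) : Prop :=
  ∀ (i : ℕ) (hi : i < h.length),
    |h[i].2 - g (h.stream.take (i + 1))| ≤ α * |g (h.stream.take (i + 1))|

end Transcript

/-- A randomized streaming algorithm that reads updates from `[n] × ℤ` and returns a real estimate
after each of them. `State` is the set of possible memory contents between two updates. On an
update the algorithm uses fresh coins to choose its next memory content and the estimate that it
returns; coins that it needs again later have to be kept in memory. -/
structure StreamingAlgorithm (n : ℕ) where
  /-- the possible memory contents -/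
  State : Type
  /-- there are finitely many of them -/
  finite_state : Finite State
  /-- the (random) initial memory content -/
  start : PMF State
  /-- the (random) next memory content and the returned estimate -/
  step : State → Update n → PMF (State × ℝ)

/-- An adaptive randomized adversary: it chooses the next update from all the previous updates and
all the estimates that were returned so far. -/
abbrev Adversary (n : ℕ) : Type := Transcript n → PMF (Update n)

namespace StreamingAlgorithm

variable {n : ℕ} (A : StreamingAlgorithm n)

/-- The space, in bits: the least `b` such that `b` bits can hold every memory content. -/
noncomputable def space : ℕ := Nat.clog 2 (Nat.card A.State)

/-- The random transcript of an execution on a fixed stream, started with memory content `s`. -/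
noncomputable def runFrom : A.State → UpdateStream n → PMF (Transcript n)
  | _, [] => PMF.pure []
  | s, u :: us =>
      (A.step s u).bind fun p => (runFrom p.1 us).map fun h => (u, p.2) :: h

/-- The random transcript of an execution on a fixed stream. -/
noncomputable def run (us : UpdateStream n) : PMF (Transcript n) :=
  A.start.bind fun s => A.runFrom s us

/-- The random final transcript of the game against an adversary when the memory content is `s`,
the transcript so far is `h`, and a given number of rounds remains to be played. In each round the
adversary chooses an update, then the algorithm processes it and returns an estimate. -/
noncomputable def playFrom (adv : Adversary n) :
    ℕ → A.State → Transcript n → PMF (Transcript n)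
  | 0, _, h => PMF.pure h
  | r + 1, s, h =>
      (adv h).bind fun u => (A.step s u).bind fun p => playFrom adv r p.1 (h ++ [(u, p.2)])

/-- The random transcript of the `m`-round game against an adversary. -/
noncomputable def play (adv : Adversary n) (m : ℕ) : PMF (Transcript n) :=
  A.start.bind fun s => A.playFrom adv m s []

/-- Accuracy in the oblivious setting: on every fixed stream of length `m` in `𝒮`, with probability
at least `p` all the estimates are `α`-accurate. -/
def ObliviouslyAccurate (g : UpdateStream n → ℝ) (𝒮 : Set (UpdateStream n)) (m : ℕ)
    (α p : ℝ) : Prop :=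
  ∀ us ∈ 𝒮, us.length = m →
    ENNReal.ofReal p ≤ (A.run us).toOuterMeasure {h | h.Accurate g α}

/-- Adversarial robustness: against every adaptive adversary, in the game of `m` rounds, with
probability at least `p` all the estimates are `α`-accurate, unless the adversary breaks the promise
that the stream belongs to `𝒮`. -/
def AdversariallyRobust (g : UpdateStream n → ℝ) (𝒮 : Set (UpdateStream n)) (m : ℕ)
    (α p : ℝ) : Prop :=
  ∀ adv : Adversary n,
    ENNReal.ofReal p ≤ (A.play adv m).toOuterMeasure {h | h.stream ∈ 𝒮 → h.Accurate g α}

/-- Every estimate that can be returned on a stream of length `m` in `𝒮` lies in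
`[-n ^ c, -1 / n ^ c] ∪ {0} ∪ [1 / n ^ c, n ^ c]`. -/
def EstimatesPolyBounded (𝒮 : Set (UpdateStream n)) (m c : ℕ) : Prop :=
  ∀ us ∈ 𝒮, us.length = m → ∀ h ∈ (A.run us).support, ∀ q ∈ h,
    q.2 = 0 ∨ (1 / (n : ℝ) ^ c ≤ |q.2| ∧ |q.2| ≤ (n : ℝ) ^ c)

end StreamingAlgorithm

/-- The `(ε, m)`-flip number of `g` on the streams in `𝒮`: the maximal number `k` of times that the
value of `g` can change by a factor above `1 + ε` or below `1 - ε` during a stream of length `m`,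
that is, there are times `t₀ < t₁ < ⋯ < tₖ ≤ m` such that the value of `g` at each `tⱼ₊₁` is outside
`(1 ± ε)` times its value at `tⱼ`. (The set is bounded by `m`.) -/
noncomputable def flipNumber {n : ℕ} (g : UpdateStream n → ℝ) (𝒮 : Set (UpdateStream n))
    (ε : ℝ) (m : ℕ) : ℕ :=
  sSup {k : ℕ | ∃ us ∈ 𝒮, us.length = m ∧ ∃ t : Fin (k + 1) → ℕ,
    StrictMono t ∧ (∀ j, t j ≤ m) ∧
    ∀ j : Fin k, ε * |g (us.take (t j.castSucc))| <
      |g (us.take (t j.succ)) - g (us.take (t j.castSucc))|}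

/-! Run `20 * K` independent copies of `A` and touch their estimates only through an exponential
mechanism, which in each round keeps the published value or moves to a point of a geometric grid. As
long as fewer than `8 * K` copies have failed and every chosen outcome scores within `K` of the
best, some accurate copy supports the published value, and every change after the first is forced by
a flip of `g` (`RobustInvariant.step`). So a budget of flip number plus two changes is never
exhausted. With `ε * K` of order `log (m / (α * δ))`, a union bound over the rounds makes mechanism
errors unlikely.

It remains to show that an adaptive adversary cannot make `8 * K` copies fail. This is a change of
measure. Fix a set `J` of `q` copies and replace the mechanism by one that is blind to them. Then
the stream is independent of these copies, and they all fail with probability at most `10⁻¹` to the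
power `q`. The inequality `2 P(E) ≤ t Q(E) + t⁻¹ E_Q[(dP/dQ)²]`, a linearized Cauchy–Schwarz,
carries this back to the real game (`two_mul_gameValue_doubleStep_le`). Averaging over `J` costs
only the ratio of binomial coefficients `(20K choose q) / (8K choose q)`
(`expect_gameValue_card_le`), and the result is at most `(93 / 100) ^ q`.

The second moment has to stay below `(11 / 10) ^ q`. Let `Λ` be the flip number, but at least `1`.
If `Λ ≥ log (1 / δ)`, the blind mechanism is the same exponential mechanism, fed with independent
substitutes for the copies in `J`. A round then contributes an excess of order `(q * ε) ^ 2` only in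
proportion to the probability of a change, as in the sparse vector technique, so the total depends
on the number of changes and not on `m` (`updateMechanism_potential`). If `Λ ≤ log (1 / δ)`, the
blind mechanism is a data-independent guess of the outcomes, whose cost is essentially the number of
possible outcome sequences (`guess_potential`). In both regimes `K` of order `√(Λ log (1 / δ)) * log
(m / (α * δ))` suffices. -/

open scoped ENNReal

/-! ### Expectations and finite product distributions -/

namespace PMF

variable {α β γ : Type*}

/-- The expectation of a nonnegative function. -/
noncomputable def expect (p : PMF α) (f : α → ℝ≥0∞) : ℝ≥0∞ := ∑' a, p a * f a

theorem expect_pure (a : α) (f : α → ℝ≥0∞) : (PMF.pure a).expect f = f a := by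
  classical
  simp only [expect, PMF.pure_apply, ite_mul, one_mul, zero_mul]
  exact tsum_ite_eq a f

theorem expect_bind (p : PMF α) (q : α → PMF β) (f : β → ℝ≥0∞) :
    (p.bind q).expect f = p.expect fun a => (q a).expect f := by
  simp only [expect, PMF.bind_apply, ← ENNReal.tsum_mul_right, ← ENNReal.tsum_mul_left]
  rw [ENNReal.tsum_comm]
  simp only [mul_assoc]

theorem expect_map (p : PMF α) (φ : α → β) (f : β → ℝ≥0∞) :
    (p.map φ).expect f = p.expect fun a => f (φ a) := by
  rw [← PMF.bind_pure_comp, expect_bind]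
  simp only [Function.comp_apply, expect_pure]

theorem expect_mono (p : PMF α) {f g : α → ℝ≥0∞} (h : ∀ a, f a ≤ g a) :
    p.expect f ≤ p.expect g :=
  ENNReal.tsum_le_tsum fun a => mul_le_mul_right (h a) _

theorem expect_mono_support (p : PMF α) {f g : α → ℝ≥0∞} (h : ∀ a ∈ p.support, f a ≤ g a) :
    p.expect f ≤ p.expect g := by
  refine ENNReal.tsum_le_tsum fun a => ?_
  by_cases ha : a ∈ p.support
  · exact mul_le_mul_right (h a ha) _
  · rw [PMF.mem_support_iff, not_not] at ha
    simp [ha]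

theorem expect_const (p : PMF α) (b : ℝ≥0∞) : (p.expect fun _ => b) = b := by
  simp only [expect, ENNReal.tsum_mul_right, PMF.tsum_coe, one_mul]

theorem expect_mul_left (p : PMF α) (b : ℝ≥0∞) (f : α → ℝ≥0∞) :
    (p.expect fun a => b * f a) = b * p.expect f := by
  simp only [expect, ← ENNReal.tsum_mul_left]
  exact tsum_congr fun a => by ring

theorem expect_add (p : PMF α) (f g : α → ℝ≥0∞) :
    (p.expect fun a => f a + g a) = p.expect f + p.expect g := by
  simp only [expect, mul_add, ENNReal.tsum_add]

theorem expect_sum {ι : Type*} (s : Finset ι) (p : PMF α) (f : ι → α → ℝ≥0∞) :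
    (p.expect fun a => ∑ i ∈ s, f i a) = ∑ i ∈ s, p.expect (f i) := by
  simp only [expect, Finset.mul_sum]
  exact Summable.tsum_finsetSum fun _ _ => ENNReal.summable

theorem expect_comm (p : PMF α) (q : PMF β) (f : α → β → ℝ≥0∞) :
    (p.expect fun a => q.expect (f a)) = q.expect fun b => p.expect fun a => f a b := by
  simp only [expect, ← ENNReal.tsum_mul_left]
  rw [ENNReal.tsum_comm]
  exact tsum_congr fun b => tsum_congr fun a => by ring

theorem expect_eq_sum [Fintype α] (p : PMF α) (f : α → ℝ≥0∞) :
    p.expect f = ∑ a, p a * f a := tsum_fintype _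

theorem toOuterMeasure_eq_expect (p : PMF α) (s : Set α) :
    p.toOuterMeasure s = p.expect (s.indicator 1) := by
  rw [PMF.toOuterMeasure_apply]
  refine tsum_congr fun a => ?_
  by_cases ha : a ∈ s <;> simp [ha]

theorem expect_indicator_add_compl (p : PMF α) (s : Set α) :
    p.expect (s.indicator 1) + p.expect (sᶜ.indicator 1) = 1 := by
  rw [← expect_add, ← p.expect_const 1]
  congr 1
  funext a
  exact congrFun (Set.indicator_self_add_compl s (1 : α → ℝ≥0∞)) a

/-- Expectations determine a distribution. -/
theorem ext_expect {p q : PMF α} (h : ∀ f, p.expect f = q.expect f) : p = q := by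
  classical
  ext a
  have := h (fun b => if b = a then 1 else 0)
  simpa [expect] using this

/-- A product of finitely many sums is the sum of all the products. -/
theorem _root_.ENNReal.tsum_prod_fin {k : ℕ} (φ : Fin k → α → ℝ≥0∞) :
    ∑' f : Fin k → α, ∏ j, φ j (f j) = ∏ j, ∑' a, φ j a := by
  induction k with
  | zero => simp
  | succ k ih =>
    rw [← (Fin.consEquiv fun _ => α).tsum_eq, ENNReal.tsum_prod', Fin.prod_univ_succ,
      ← ih fun j => φ j.succ, ← ENNReal.tsum_mul_right]
    refine tsum_congr fun a => ?_
    rw [← ENNReal.tsum_mul_left]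
    refine tsum_congr fun f => ?_
    rw [Fin.prod_univ_succ]
    rfl

/-- The product distribution of finitely many independent samples. -/
noncomputable def pi {k : ℕ} (p : Fin k → PMF α) : PMF (Fin k → α) :=
  ⟨fun f => ∏ j, p j (f j), by
    rw [ENNReal.summable.hasSum_iff, ENNReal.tsum_prod_fin]
    simp [PMF.tsum_coe]⟩

theorem pi_apply {k : ℕ} (p : Fin k → PMF α) (f : Fin k → α) : pi p f = ∏ j, p j (f j) := rfl

theorem expect_pi_prod {k : ℕ} (p : Fin k → PMF α) (J : Finset (Fin k)) (ψ : Fin k → α → ℝ≥0∞) :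
    ((pi p).expect fun f => ∏ j ∈ J, ψ j (f j)) = ∏ j ∈ J, (p j).expect (ψ j) := by
  have h : ∀ f : Fin k → α, ∏ j ∈ J, ψ j (f j) = ∏ j, if j ∈ J then ψ j (f j) else 1 := fun f => by
    rw [Finset.prod_ite_mem, Finset.univ_inter]
  simp only [expect, pi_apply, h, ← Finset.prod_mul_distrib]
  have h' : ∏ j ∈ J, ∑' a, p j a * ψ j a = ∏ j, if j ∈ J then ∑' a, p j a * ψ j a else 1 := by
    rw [Finset.prod_ite_mem, Finset.univ_inter]
  rw [ENNReal.tsum_prod_fin fun j a => p j a * if j ∈ J then ψ j a else 1, h']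
  refine Finset.prod_congr rfl fun j _ => ?_
  split_ifs <;> simp [PMF.tsum_coe]

theorem pi_map {k : ℕ} (p : Fin k → PMF α) (φ : Fin k → α → β) :
    ((pi p).map fun f j => φ j (f j)) = pi fun j => (p j).map (φ j) := by
  classical
  ext g
  rw [PMF.map_apply, pi_apply]
  simp only [PMF.map_apply]
  rw [← ENNReal.tsum_prod_fin fun j a => if g j = φ j a then p j a else 0]
  refine tsum_congr fun f => ?_
  rw [Finset.prod_ite_zero]
  simp [funext_iff, pi_apply]

/-- Independent samples from two product distributions form a product distribution of pairs. -/
theorem expect_pi_pair {k : ℕ} (p : Fin k → PMF α) (q : Fin k → PMF β)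
    (F : (Fin k → α) → (Fin k → β) → ℝ≥0∞) :
    ((pi p).expect fun a => (pi q).expect (F a)) =
      (pi fun j => (p j).bind fun a => (q j).map (Prod.mk a)).expect
        fun f => F (fun j => (f j).1) (fun j => (f j).2) := by
  classical
  have hpair : ∀ j (x : α × β),
      ((p j).bind fun a => (q j).map (Prod.mk a)) x = p j x.1 * q j x.2 := by
    intro j x
    rw [PMF.bind_apply, tsum_eq_single x.1]
    · rw [PMF.map_apply, tsum_eq_single x.2]
      · simp
      · intro b hb
        rw [if_neg]
        rintro h
        exact hb (by rw [h])
    · intro a ha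
      rw [PMF.map_apply, ENNReal.tsum_eq_zero.2, mul_zero]
      intro b
      rw [if_neg]
      rintro h
      exact ha (by rw [h])
  simp only [expect, pi_apply, hpair, ← ENNReal.tsum_mul_left]
  rw [← ENNReal.tsum_prod, ← (Equiv.arrowProdEquivProdArrow (Fin k) (fun _ => α) fun _ => β).tsum_eq]
  refine tsum_congr fun f => ?_
  rw [Finset.prod_mul_distrib, mul_assoc]
  rfl

/-- Selecting, coordinate by coordinate, from one of two independent families. -/
theorem expect_pi_select {k : ℕ} (p q : Fin k → PMF α) (J : Finset (Fin k))
    (F : (Fin k → α) → ℝ≥0∞) :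
    ((pi p).expect fun a => (pi q).expect fun b => F fun j => if j ∈ J then b j else a j) =
      (pi fun j => if j ∈ J then q j else p j).expect F := by
  rw [expect_pi_pair p q fun a b => F fun j => if j ∈ J then b j else a j]
  rw [← expect_map _ (fun (f : Fin k → α × α) j => if j ∈ J then (f j).2 else (f j).1) F,
    pi_map _ fun j (x : α × α) => if j ∈ J then x.2 else x.1]
  congr 2
  funext j
  split_ifs
  · refine ext_expect fun f => ?_
    simp [expect_bind, expect_map, expect_const]
  · refine ext_expect fun f => ?_
    simp [expect_bind, expect_map, expect_const]

end PMF

/-! ### Values of adaptive games -/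

section Game

variable {n : ℕ} {σ τ : Type*}

/-- The expected payoff at the end of the game in which the machine `step` answers an adversary,
when a given number of rounds remains to be played. -/
noncomputable def gameValue (step : σ → Update n → PMF (σ × ℝ)) (adv : Adversary n)
    (Φ : σ → Transcript n → ℝ≥0∞) : ℕ → σ → Transcript n → ℝ≥0∞
  | 0, s, h => Φ s h
  | r + 1, s, h =>
      (adv h).expect fun u => (step s u).expect fun p => gameValue step adv Φ r p.1 (h ++ [(u, p.2)])

theorem gameValue_mono (step : σ → Update n → PMF (σ × ℝ)) (adv : Adversary n)
    {Φ Ψ : σ → Transcript n → ℝ≥0∞} (r : ℕ) (s : σ) (h : Transcript n)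
    (hΦ : ∀ s' h', h <+: h' → h'.length = h.length + r → Φ s' h' ≤ Ψ s' h') :
    gameValue step adv Φ r s h ≤ gameValue step adv Ψ r s h := by
  induction r generalizing s h with
  | zero => exact hΦ s h (List.prefix_refl h) rfl
  | succ r ih =>
    refine PMF.expect_mono _ fun u => PMF.expect_mono _ fun p => ih _ _ fun s' h' hp hl => ?_
    refine hΦ s' h' ((List.prefix_append h _).trans hp) ?_
    rw [hl, List.length_append, List.length_singleton]
    ring

theorem gameValue_congr (step : σ → Update n → PMF (σ × ℝ)) (adv : Adversary n)
    {Φ Ψ : σ → Transcript n → ℝ≥0∞} (r : ℕ) (s : σ) (h : Transcript n)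
    (hΦ : ∀ s' h', h <+: h' → h'.length = h.length + r → Φ s' h' = Ψ s' h') :
    gameValue step adv Φ r s h = gameValue step adv Ψ r s h :=
  le_antisymm (gameValue_mono _ _ _ _ _ fun s' h' hp hl => (hΦ s' h' hp hl).le)
    (gameValue_mono _ _ _ _ _ fun s' h' hp hl => (hΦ s' h' hp hl).ge)

theorem gameValue_const (step : σ → Update n → PMF (σ × ℝ)) (adv : Adversary n) (b : ℝ≥0∞)
    (r : ℕ) (s : σ) (h : Transcript n) : gameValue step adv (fun _ _ => b) r s h = b := by
  induction r generalizing s h with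
  | zero => rfl
  | succ r ih => simp only [gameValue, ih, PMF.expect_const]

theorem gameValue_le_const (step : σ → Update n → PMF (σ × ℝ)) (adv : Adversary n)
    {Φ : σ → Transcript n → ℝ≥0∞} {b : ℝ≥0∞} (r : ℕ) (s : σ) (h : Transcript n)
    (hΦ : ∀ s' h', h <+: h' → h'.length = h.length + r → Φ s' h' ≤ b) :
    gameValue step adv Φ r s h ≤ b :=
  (gameValue_mono step adv r s h hΦ).trans_eq (gameValue_const step adv b r s h)

theorem gameValue_add (step : σ → Update n → PMF (σ × ℝ)) (adv : Adversary n)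
    (Φ Ψ : σ → Transcript n → ℝ≥0∞) (r : ℕ) (s : σ) (h : Transcript n) :
    gameValue step adv (fun s h => Φ s h + Ψ s h) r s h =
      gameValue step adv Φ r s h + gameValue step adv Ψ r s h := by
  induction r generalizing s h with
  | zero => rfl
  | succ r ih => simp only [gameValue, ih, PMF.expect_add]

theorem gameValue_mul_left (step : σ → Update n → PMF (σ × ℝ)) (adv : Adversary n) (b : ℝ≥0∞)
    (Φ : σ → Transcript n → ℝ≥0∞) (r : ℕ) (s : σ) (h : Transcript n) :
    gameValue step adv (fun s h => b * Φ s h) r s h = b * gameValue step adv Φ r s h := by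
  induction r generalizing s h with
  | zero => rfl
  | succ r ih => simp only [gameValue, ih, PMF.expect_mul_left]

theorem gameValue_sum {ι : Type*} (I : Finset ι) (step : σ → Update n → PMF (σ × ℝ))
    (adv : Adversary n) (Φ : ι → σ → Transcript n → ℝ≥0∞) (r : ℕ) (s : σ) (h : Transcript n) :
    gameValue step adv (fun s h => ∑ i ∈ I, Φ i s h) r s h =
      ∑ i ∈ I, gameValue step adv (Φ i) r s h := by
  induction r generalizing s h with
  | zero => rfl
  | succ r ih => simp only [gameValue, ih, PMF.expect_sum]

theorem expect_gameValue {α : Type*} (p : PMF α) (step : σ → Update n → PMF (σ × ℝ))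
    (adv : Adversary n) (Φ : α → σ → Transcript n → ℝ≥0∞) (r : ℕ) (s : σ) (h : Transcript n) :
    (p.expect fun a => gameValue step adv (Φ a) r s h) =
      gameValue step adv (fun s h => p.expect fun a => Φ a s h) r s h := by
  induction r generalizing s h with
  | zero => rfl
  | succ r ih =>
    simp only [gameValue, ← ih]
    rw [PMF.expect_comm]
    congr 1
    funext u
    rw [PMF.expect_comm]

/-- A projection of the memory contents that is compatible with the transitions preserves the
values of games. -/
theorem gameValue_comp (step : σ → Update n → PMF (σ × ℝ)) (step' : τ → Update n → PMF (τ × ℝ))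
    (φ : σ → τ)
    (hφ : ∀ s u (F : τ × ℝ → ℝ≥0∞),
      ((step s u).expect fun p => F (φ p.1, p.2)) = (step' (φ s) u).expect F)
    (adv : Adversary n) (Φ : τ → Transcript n → ℝ≥0∞) (r : ℕ) (s : σ) (h : Transcript n) :
    gameValue step adv (fun s => Φ (φ s)) r s h = gameValue step' adv Φ r (φ s) h := by
  induction r generalizing s h with
  | zero => rfl
  | succ r ih =>
    simp only [gameValue, ih]
    congr 1
    funext u
    exact hφ s u fun p => gameValue step' adv Φ r p.1 (h ++ [(u, p.2)])

theorem StreamingAlgorithm.expect_playFrom (A : StreamingAlgorithm n) (adv : Adversary n)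
    (Φ : Transcript n → ℝ≥0∞) (r : ℕ) (s : A.State) (h : Transcript n) :
    (A.playFrom adv r s h).expect Φ = gameValue A.step adv (fun _ => Φ) r s h := by
  induction r generalizing s h with
  | zero => exact PMF.expect_pure h Φ
  | succ r ih => simp only [playFrom, PMF.expect_bind, gameValue, ih]

theorem StreamingAlgorithm.expect_play (A : StreamingAlgorithm n) (adv : Adversary n)
    (Φ : Transcript n → ℝ≥0∞) (m : ℕ) :
    (A.play adv m).expect Φ = A.start.expect fun s => gameValue A.step adv (fun _ => Φ) m s [] := by
  simp only [play, PMF.expect_bind, expect_playFrom]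

end Game

/-! ### Ensembles of copies and change of mechanism -/

section Ensemble

variable {n k : ℕ} {S V O : Type*}

/-- One step of an ensemble of `k` copies of a machine. Their estimates are handed over to a
mechanism, which chooses an outcome; the outcome determines the next control state, and the control
state determines the estimate that is returned. -/
noncomputable def ensembleStep (κ : S → Update n → PMF (S × ℝ)) (mech : V → (Fin k → ℝ) → PMF O)
    (next : V → O → V) (out : V → ℝ) (s : (Fin k → S) × V) (u : Update n) :
    PMF (((Fin k → S) × V) × ℝ) :=
  (PMF.pi fun j => κ (s.1 j) u).bind fun a =>
    (mech s.2 fun j => (a j).2).map fun o =>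
      ((fun j => (a j).1, next s.2 o), out (next s.2 o))

/-- One step of two independent ensembles of `k` copies of a machine, with a mechanism that sees
the estimates of both. -/
noncomputable def doubleStep (κ : S → Update n → PMF (S × ℝ))
    (mech : V → (Fin k → ℝ) → (Fin k → ℝ) → PMF O)
    (next : V → O → V) (out : V → ℝ) (s : ((Fin k → S) × (Fin k → S)) × V) (u : Update n) :
    PMF ((((Fin k → S) × (Fin k → S)) × V) × ℝ) :=
  (PMF.pi fun j => κ (s.1.1 j) u).bind fun a => (PMF.pi fun j => κ (s.1.2 j) u).bind fun b =>
    (mech s.2 (fun j => (a j).2) fun j => (b j).2).map fun o =>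
      (((fun j => (a j).1, fun j => (b j).1), next s.2 o), out (next s.2 o))

/-- The family that agrees with `b` on `J` and with `a` elsewhere. -/
def selectOn {X : Type*} (J : Finset (Fin k)) (a b : Fin k → X) (j : Fin k) : X :=
  if j ∈ J then b j else a j

theorem selectOn_comp {X Y : Type*} (J : Finset (Fin k)) (a b : Fin k → X) (f : X → Y) :
    (fun j => f (selectOn J a b j)) = selectOn J (fun j => f (a j)) fun j => f (b j) := by
  funext j
  unfold selectOn
  split_ifs <;> rfl

/-- If the mechanism of a double ensemble only uses one selection of `k` copies, then those copies
form an ensemble. -/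
theorem gameValue_doubleStep_selectOn (κ : S → Update n → PMF (S × ℝ))
    (mech : V → (Fin k → ℝ) → PMF O) (next : V → O → V) (out : V → ℝ) (J : Finset (Fin k))
    (adv : Adversary n) (Φ : (Fin k → S) × V → Transcript n → ℝ≥0∞) (r : ℕ)
    (s : ((Fin k → S) × (Fin k → S)) × V) (h : Transcript n) :
    gameValue (doubleStep κ (fun v a b => mech v (selectOn J a b)) next out) adv
        (fun s => Φ (selectOn J s.1.1 s.1.2, s.2)) r s h =
      gameValue (ensembleStep κ mech next out) adv Φ r (selectOn J s.1.1 s.1.2, s.2) h := by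
  refine gameValue_comp _ _ (fun s : ((Fin k → S) × (Fin k → S)) × V =>
    (selectOn J s.1.1 s.1.2, s.2)) (fun s u F => ?_) adv Φ r s h
  simp only [doubleStep, ensembleStep, PMF.expect_bind, PMF.expect_map, ← selectOn_comp]
  rw [show (fun j => κ (selectOn J s.1.1 s.1.2 j) u) =
      fun j => if j ∈ J then κ (s.1.2 j) u else κ (s.1.1 j) u from
    selectOn_comp J s.1.1 s.1.2 fun x => κ x u, ← PMF.expect_pi_select]
  rfl

theorem ENNReal.two_le_add_inv {t : ℝ≥0∞} (h0 : t ≠ 0) (ht : t ≠ ∞) : 2 ≤ t + t⁻¹ := by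
  lift t to NNReal using ht
  have h0' : t ≠ 0 := by exact_mod_cast h0
  rw [← ENNReal.coe_inv h0']
  norm_cast
  have hpos : (0 : ℝ) < t := by positivity
  rw [← NNReal.coe_le_coe]
  push_cast
  field_simp
  nlinarith [sq_nonneg ((t : ℝ) - 1)]

/-- One outcome of the induction behind the change of measure. Because the hypothesis is available
for every scale, it can be applied at `t * q / p`, that is, with the scale corrected by the
likelihood ratio of this outcome. Multiplication by `p` then turns the last term into a contribution
to the second moment. -/
theorem ENNReal.two_mul_le_of_forall_scale {p q F G c t : ℝ≥0∞} (hp : p ≠ ∞) (hq : q ≠ ∞)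
    (hc : c ≠ 0) (ht0 : t ≠ 0) (ht : t ≠ ∞)
    (H : ∀ t : ℝ≥0∞, t ≠ 0 → t ≠ ∞ → 2 * F ≤ t * G + t⁻¹ * c) :
    2 * (p * F) ≤ t * (q * G) + t⁻¹ * (p ^ 2 / q * c) := by
  rcases eq_or_ne p 0 with rfl | hp0
  · simp
  -- An outcome that is impossible under the second mechanism makes `p ^ 2 / q` infinite, and the
  -- bound is trivial; this is where `c ≠ 0` is needed.
  rcases eq_or_ne q 0 with rfl | hq0
  · rw [ENNReal.div_zero (pow_ne_zero 2 hp0), ENNReal.top_mul hc,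
      ENNReal.mul_top (ENNReal.inv_ne_zero.2 ht), add_top]
    exact le_top
  have key := mul_le_mul_right (H (t * q / p)
    (ENNReal.div_ne_zero.2 ⟨mul_ne_zero ht0 hq0, hp⟩)
    (ENNReal.div_ne_top (ENNReal.mul_ne_top ht hq) hp0)) p
  have e1 : p * (t * q / p * G) = t * (q * G) := by
    rw [← mul_assoc, ENNReal.mul_div_cancel hp0 hp, mul_assoc]
  have e2 : p * ((t * q / p)⁻¹ * c) = t⁻¹ * (p ^ 2 / q * c) := by
    rw [ENNReal.inv_div (Or.inl hp) (Or.inl hp0), div_eq_mul_inv, div_eq_mul_inv,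
      ENNReal.mul_inv (Or.inl ht0) (Or.inl ht)]
    ring
  rw [mul_add, e1, e2] at key
  calc 2 * (p * F) = p * (2 * F) := by ring
    _ ≤ _ := key

/-- Comparison of two mechanisms by means of a potential that controls the second moment of their
likelihood ratio. -/
theorem two_mul_gameValue_doubleStep_le [Fintype O] (κ : S → Update n → PMF (S × ℝ))
    (P Q : V → (Fin k → ℝ) → (Fin k → ℝ) → PMF O) (next : V → O → V) (out : V → ℝ)
    (pot : ℕ → V → ℝ≥0∞) (hpot1 : ∀ r v, 1 ≤ pot r v)
    (hpot : ∀ r v a b, ∑ o, P v a b o ^ 2 / Q v a b o * pot r (next v o) ≤ pot (r + 1) v)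
    (adv : Adversary n) (Φ : ((Fin k → S) × (Fin k → S)) × V → Transcript n → ℝ≥0∞)
    (hΦ : ∀ s h, Φ s h ≤ 1) (r : ℕ) (s : ((Fin k → S) × (Fin k → S)) × V) (h : Transcript n)
    (t : ℝ≥0∞) (ht0 : t ≠ 0) (ht : t ≠ ∞) :
    2 * gameValue (doubleStep κ P next out) adv Φ r s h ≤
      t * gameValue (doubleStep κ Q next out) adv Φ r s h + t⁻¹ * pot r s.2 := by
  induction r generalizing s h t with
  | zero =>
    calc 2 * Φ s h ≤ (t + t⁻¹) * Φ s h := mul_le_mul_left (ENNReal.two_le_add_inv ht0 ht) _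
      _ = t * Φ s h + t⁻¹ * Φ s h := add_mul _ _ _
      _ ≤ t * Φ s h + t⁻¹ * pot 0 s.2 := by
        gcongr
        exact (hΦ s h).trans (hpot1 0 _)
  | succ r ih =>
    simp only [gameValue]
    rw [← PMF.expect_mul_left, ← PMF.expect_mul_left,
      ← (adv h).expect_const (t⁻¹ * pot (r + 1) s.2), ← PMF.expect_add]
    refine PMF.expect_mono _ fun u => ?_
    simp only [doubleStep, PMF.expect_bind, PMF.expect_map]
    rw [← PMF.expect_mul_left, ← PMF.expect_mul_left,
      ← (PMF.pi fun j => κ (s.1.1 j) u).expect_const (t⁻¹ * pot (r + 1) s.2), ← PMF.expect_add]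
    refine PMF.expect_mono _ fun a => ?_
    rw [← PMF.expect_mul_left, ← PMF.expect_mul_left,
      ← (PMF.pi fun j => κ (s.1.2 j) u).expect_const (t⁻¹ * pot (r + 1) s.2), ← PMF.expect_add]
    refine PMF.expect_mono _ fun b => ?_
    rw [PMF.expect_eq_sum, PMF.expect_eq_sum, Finset.mul_sum, Finset.mul_sum]
    -- Each outcome uses the induction hypothesis at its own scale. The remaining terms add up to
    -- the one-step second moment weighted by the later potential, which `hpot` bounds.
    refine le_trans (Finset.sum_le_sum fun o _ => ENNReal.two_mul_le_of_forall_scale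
      (q := Q s.2 (fun j => (a j).2) (fun j => (b j).2) o)
      (PMF.apply_ne_top _ o) (PMF.apply_ne_top _ o)
      (one_pos.trans_le (hpot1 r (next s.2 o))).ne' ht0 ht fun t ht0 ht => ih _ _ t ht0 ht) ?_
    rw [Finset.sum_add_distrib]
    refine add_le_add le_rfl ?_
    rw [← Finset.mul_sum]
    exact mul_le_mul_right (hpot r s.2 _ _) _

end Ensemble

/-! ### Decoupling: copies that the mechanism does not see -/

namespace StreamingAlgorithm

variable {n : ℕ} (A : StreamingAlgorithm n)

/-- The machine `A` together with a record of its own execution. -/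
noncomputable def recordStep (s : A.State × Transcript n) (u : Update n) :
    PMF ((A.State × Transcript n) × ℝ) :=
  (A.step s.1 u).map fun p => ((p.1, s.2 ++ [(u, p.2)]), p.2)

/-- The expectation of a function of the transcript when a given stream remains to be read. -/
noncomputable def tailValue (f : Transcript n → ℝ≥0∞) (s : A.State × Transcript n)
    (us : UpdateStream n) : ℝ≥0∞ :=
  (A.runFrom s.1 us).expect fun h => f (s.2 ++ h)

theorem tailValue_nil (f : Transcript n → ℝ≥0∞) (s : A.State × Transcript n) :
    A.tailValue f s [] = f s.2 := by
  simp [tailValue, runFrom, PMF.expect_pure]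

theorem expect_recordStep_tailValue (f : Transcript n → ℝ≥0∞) (s : A.State × Transcript n)
    (u : Update n) (us : UpdateStream n) :
    ((A.recordStep s u).expect fun p => A.tailValue f p.1 us) = A.tailValue f s (u :: us) := by
  simp [tailValue, runFrom, recordStep, PMF.expect_map, PMF.expect_bind]

theorem expect_start_tailValue (f : Transcript n → ℝ≥0∞) (us : UpdateStream n) :
    (A.start.expect fun s => A.tailValue f (s, []) us) = (A.run us).expect f := by
  simp [tailValue, run, PMF.expect_bind]

variable {k : ℕ} {V O : Type*}

/-- Copies of a machine that the mechanism ignores are independent executions on the stream that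
the adversary plays. -/
theorem gameValue_observers (mech : V → (Fin k → ℝ) → PMF O) (next : V → O → V) (out : V → ℝ)
    (adv : Adversary n) (J : Finset (Fin k)) (ind f : Transcript n → ℝ≥0∞) (r : ℕ)
    (s : ((Fin k → A.State × Transcript n) × (Fin k → A.State × Transcript n)) × V)
    (h : Transcript n) :
    gameValue (doubleStep A.recordStep (fun v a _ => mech v a) next out) adv
        (fun s h => ind h * ∏ j ∈ J, f (s.1.2 j).2) r s h =
      gameValue (ensembleStep A.recordStep mech next out) adv
        (fun _ h' => ind h' * ∏ j ∈ J, A.tailValue f (s.1.2 j) (h'.stream.drop h.length)) r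
        (s.1.1, s.2) h := by
  induction r generalizing s h with
  | zero =>
    simp only [gameValue]
    rw [List.drop_eq_nil_of_le (by simp [Transcript.stream])]
    simp only [tailValue_nil]
  | succ r ih =>
    simp only [gameValue, ih]
    congr 1
    funext u
    simp only [doubleStep, ensembleStep, PMF.expect_bind, PMF.expect_map]
    congr 1
    funext a
    -- The outcome does not depend on the ignored copies, so their step can be averaged last, with
    -- the future of the game already fixed.
    rw [PMF.expect_comm]
    congr 1
    funext o
    rw [expect_gameValue]
    refine gameValue_congr _ _ _ _ _ fun _ h' hp _ => ?_
    rw [PMF.expect_mul_left, PMF.expect_pi_prod _ J fun j (x : (A.State × Transcript n) × ℝ) =>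
      A.tailValue f x.1 _]
    simp only [expect_recordStep_tailValue]
    obtain ⟨h'', rfl⟩ := hp
    simp [Transcript.stream, List.drop_append, List.drop_eq_nil_of_le]

/-- On an ensemble of independent executions, each of `|J|` many fails with probability at most
`η`. -/
theorem expect_gameValue_observers_le (mech : V → (Fin k → ℝ) → PMF O) (next : V → O → V)
    (out : V → ℝ) (adv : Adversary n) (J : Finset (Fin k)) (ind f : Transcript n → ℝ≥0∞) (η : ℝ≥0∞)
    (m : ℕ) (hind : ∀ h, ind h ≤ 1)
    (hf : ∀ h : Transcript n, h.length = m → ind h ≠ 0 → (A.run h.stream).expect f ≤ η)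
    (y : Fin k → A.State × Transcript n) (v : V) :
    ((PMF.pi fun _ : Fin k => A.start).expect fun s =>
      gameValue (doubleStep A.recordStep (fun v a _ => mech v a) next out) adv
        (fun s h => ind h * ∏ j ∈ J, f (s.1.2 j).2) m ((y, fun j => (s j, [])), v) []) ≤
      η ^ J.card := by
  simp only [gameValue_observers, expect_gameValue]
  refine gameValue_le_const _ _ _ _ _ fun _ h _ hl => ?_
  rw [PMF.expect_mul_left, PMF.expect_pi_prod _ J fun _ (x : A.State) => A.tailValue f (x, []) _]
  simp only [expect_start_tailValue, List.length_nil, List.drop_zero, Finset.prod_const]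
  rcases eq_or_ne (ind h) 0 with h0 | h0
  · simp [h0]
  · calc _ ≤ 1 * η ^ J.card := by
          gcongr
          · exact hind h
          · exact hf h (by simpa using hl) h0
      _ = _ := one_mul _

end StreamingAlgorithm

theorem selectOn_of_mem {k : ℕ} {X : Type*} {J : Finset (Fin k)} (a b : Fin k → X) {j : Fin k}
    (hj : j ∈ J) : selectOn J a b j = b j := if_pos hj

open Classical in
/-- The number of copies whose recorded execution belongs to a set. -/
noncomputable def failCount {n k : ℕ} {S : Type*} (bad : Set (Transcript n))
    (x : Fin k → S × Transcript n) : ℕ :=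
  (Finset.univ.filter fun j => (x j).2 ∈ bad).card

namespace StreamingAlgorithm

variable {n : ℕ} (A : StreamingAlgorithm n) {k : ℕ} {V O : Type*}

/-- The probability that all the copies in `J` fail, by comparison with a mechanism that does not
see those copies. -/
theorem two_mul_expect_gameValue_prod_le [Fintype O] (mech : V → (Fin k → ℝ) → PMF O)
    (mechQ : V → (Fin k → ℝ) → PMF O) (next : V → O → V) (out : V → ℝ) (J : Finset (Fin k))
    (pot : ℕ → V → ℝ≥0∞) (hpot1 : ∀ r v, 1 ≤ pot r v)
    (hpot : ∀ r v a b, ∑ o, mech v (selectOn J a b) o ^ 2 / mechQ v a o * pot r (next v o) ≤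
      pot (r + 1) v)
    (adv : Adversary n) (ind f : Transcript n → ℝ≥0∞) (η : ℝ≥0∞) (m : ℕ) (hind : ∀ h, ind h ≤ 1)
    (hf1 : ∀ h, f h ≤ 1)
    (hf : ∀ h : Transcript n, h.length = m → ind h ≠ 0 → (A.run h.stream).expect f ≤ η)
    (v : V) (t : ℝ≥0∞) (ht0 : t ≠ 0) (ht : t ≠ ∞) :
    2 * (PMF.pi fun _ : Fin k => A.start).expect (fun s =>
      gameValue (ensembleStep A.recordStep mech next out) adv
        (fun s h => ind h * ∏ j ∈ J, f (s.1 j).2) m (fun j => (s j, []), v) []) ≤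
      t * η ^ J.card + t⁻¹ * pot m v := by
  -- The real ensemble is viewed as a selection from two independent ensembles: the copies in `J`
  -- come from the second, the others from the first. The unused copies of the first are the
  -- substitutes for `J`.
  have hsel : (PMF.pi fun _ : Fin k => A.start) =
      PMF.pi fun j => if j ∈ J then A.start else A.start := by simp
  rw [hsel, ← PMF.expect_pi_select, ← PMF.expect_mul_left]
  refine le_trans (PMF.expect_mono (g := fun _ => t * η ^ J.card + t⁻¹ * pot m v) _ fun y => ?_)
    (PMF.expect_const _ _).le
  have hcard := A.expect_gameValue_observers_le mechQ next out adv J ind f η m hind hf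
    (fun j => (y j, [])) v
  refine le_trans ?_ (add_le_add (mul_le_mul_right hcard t) le_rfl)
  rw [← PMF.expect_mul_left, ← PMF.expect_mul_left,
    ← (PMF.pi fun _ : Fin k => A.start).expect_const (t⁻¹ * pot m v), ← PMF.expect_add]
  refine PMF.expect_mono _ fun b => ?_
  have hc := two_mul_gameValue_doubleStep_le A.recordStep
    (fun v a b => mech v (selectOn J a b)) (fun v a _ => mechQ v a) next out pot hpot1 hpot adv
    (fun s h => ind h * ∏ j ∈ J, f (s.1.2 j).2)
    (fun s h => mul_le_one' (hind h) (Finset.prod_le_one' fun j _ => hf1 _)) m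
    (((fun j => (y j, [])), fun j => (b j, [])), v) [] t ht0 ht
  refine le_trans (le_of_eq ?_) hc
  congr 1
  have hproj := gameValue_doubleStep_selectOn A.recordStep mech next out J adv
    (fun s h => ind h * ∏ j ∈ J, f (s.1 j).2) m
    (((fun j => (y j, [])), fun j => (b j, [])), v) []
  rw [← selectOn_comp J y b fun x => (x, ([] : Transcript n))] at hproj
  refine hproj.symm.trans ?_
  congr 1
  funext s h
  refine congrArg (ind h * ·) (Finset.prod_congr rfl fun j hj => ?_)
  simp only [selectOn_of_mem _ _ hj]

/-- The probability that many copies fail. -/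
theorem expect_gameValue_card_le [Fintype O] (mech : V → (Fin k → ℝ) → PMF O)
    (next : V → O → V) (out : V → ℝ) (q M : ℕ) (pot : ℕ → V → ℝ≥0∞) (hpot1 : ∀ r v, 1 ≤ pot r v)
    (hpot : ∀ J : Finset (Fin k), J.card = q → ∃ mechQ : V → (Fin k → ℝ) → PMF O, ∀ r v a b,
      ∑ o, mech v (selectOn J a b) o ^ 2 / mechQ v a o * pot r (next v o) ≤ pot (r + 1) v)
    (adv : Adversary n) (ind : Transcript n → ℝ≥0∞) (bad : Set (Transcript n)) (η : ℝ≥0∞) (m : ℕ)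
    (hind : ∀ h, ind h ≤ 1)
    (hf : ∀ h : Transcript n, h.length = m → ind h ≠ 0 →
      (A.run h.stream).expect (bad.indicator 1) ≤ η)
    (v : V) (t : ℝ≥0∞) (ht0 : t ≠ 0) (ht : t ≠ ∞) :
    2 * (M.choose q : ℝ≥0∞) * (PMF.pi fun _ : Fin k => A.start).expect (fun s =>
      gameValue (ensembleStep A.recordStep mech next out) adv
        (fun s h => ind h * if M ≤ failCount bad s.1 then 1 else 0)
        m (fun j => (s j, []), v) []) ≤
      k.choose q * (t * η ^ q + t⁻¹ * pot m v) := by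
  classical
  -- A binomial-moment form of Markov's inequality: when at least `M` copies fail, at least
  -- `M.choose q` of the `q`-sets consist of failing copies only.
  have hpt : ∀ (s : (Fin k → A.State × Transcript n) × V) (h : Transcript n),
      (M.choose q : ℝ≥0∞) * (ind h *
        if M ≤ failCount bad s.1 then 1 else 0) ≤
      ∑ J ∈ (Finset.univ : Finset (Fin k)).powersetCard q,
        ind h * ∏ j ∈ J, bad.indicator 1 (s.1 j).2 := by
    intro s h
    split_ifs with hM
    · rw [mul_one, mul_comm, ← Finset.mul_sum]
      gcongr
      set F := Finset.univ.filter fun j => (s.1 j).2 ∈ bad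
      calc (M.choose q : ℝ≥0∞) ≤ F.card.choose q := by exact_mod_cast Nat.choose_le_choose q hM
        _ = ∑ J ∈ F.powersetCard q, 1 := by simp
        _ = ∑ J ∈ F.powersetCard q, ∏ j ∈ J, bad.indicator (1 : Transcript n → ℝ≥0∞) (s.1 j).2 := by
          refine Finset.sum_congr rfl fun J hJ => (Finset.prod_eq_one fun j hj => ?_).symm
          have := (Finset.mem_powersetCard.1 hJ).1 hj
          exact Set.indicator_of_mem (Finset.mem_filter.1 this).2 _
        _ ≤ _ := Finset.sum_le_sum_of_subset (Finset.powersetCard_mono (Finset.subset_univ F))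
    · simp
  rw [mul_assoc, ← PMF.expect_mul_left]
  simp only [← gameValue_mul_left]
  calc _ ≤ 2 * (PMF.pi fun _ : Fin k => A.start).expect (fun s =>
        ∑ J ∈ (Finset.univ : Finset (Fin k)).powersetCard q,
        gameValue (ensembleStep A.recordStep mech next out) adv
          (fun s h => ind h * ∏ j ∈ J, bad.indicator 1 (s.1 j).2) m (fun j => (s j, []), v) []) := by
        gcongr
        refine PMF.expect_mono _ fun s => ?_
        rw [← gameValue_sum]
        exact gameValue_mono _ _ _ _ _ fun s h _ _ => hpt s h
    _ = ∑ J ∈ (Finset.univ : Finset (Fin k)).powersetCard q,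
        2 * (PMF.pi fun _ : Fin k => A.start).expect (fun s =>
        gameValue (ensembleStep A.recordStep mech next out) adv
          (fun s h => ind h * ∏ j ∈ J, bad.indicator 1 (s.1 j).2) m (fun j => (s j, []), v) []) := by
        rw [PMF.expect_sum, Finset.mul_sum]
    _ ≤ ∑ J ∈ (Finset.univ : Finset (Fin k)).powersetCard q, (t * η ^ q + t⁻¹ * pot m v) := by
        refine Finset.sum_le_sum fun J hJ => ?_
        obtain ⟨mechQ, hQ⟩ := hpot J (Finset.mem_powersetCard.1 hJ).2
        have := A.two_mul_expect_gameValue_prod_le mech mechQ next out J pot hpot1 hQ adv ind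
          (bad.indicator 1) η m hind (fun h => Set.indicator_le_self' (by simp) h) hf v t ht0 ht
        rwa [(Finset.mem_powersetCard.1 hJ).2] at this
    _ = _ := by
        rw [Finset.sum_const, Finset.card_powersetCard, Finset.card_fin, nsmul_eq_mul]

end StreamingAlgorithm

/-! ### The exponential mechanism -/

section Softmax

variable {O : Type*} [Fintype O] [Nonempty O]

theorem sum_exp_pos (w : O → ℝ) : 0 < ∑ o, Real.exp (w o) :=
  Finset.sum_pos (fun _ _ => Real.exp_pos _) Finset.univ_nonempty

/-- The distribution of the exponential mechanism with logarithmic weights `w`. -/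
noncomputable def softmax (w : O → ℝ) : PMF O :=
  PMF.ofFintype (fun o => ENNReal.ofReal (Real.exp (w o) / ∑ o', Real.exp (w o'))) (by
    rw [← ENNReal.ofReal_sum_of_nonneg fun o _ =>
      div_nonneg (Real.exp_pos _).le (sum_exp_pos w).le, ← Finset.sum_div,
      div_self (sum_exp_pos w).ne', ENNReal.ofReal_one])

theorem softmax_apply (w : O → ℝ) (o : O) :
    softmax w o = ENNReal.ofReal (Real.exp (w o) / ∑ o', Real.exp (w o')) := rfl

/-- The exponential mechanism rarely selects an outcome whose weight is far from maximal. -/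
theorem softmax_expect_le (w : O → ℝ) (d : ℝ) :
    (softmax w).expect ({o | ∃ o', w o + d ≤ w o'}.indicator 1) ≤
      ENNReal.ofReal (Fintype.card O * Real.exp (-d)) := by
  classical
  rw [PMF.expect_eq_sum, ENNReal.ofReal_mul (by positivity), ENNReal.ofReal_natCast]
  refine (Finset.sum_le_card_nsmul _ _ (ENNReal.ofReal (Real.exp (-d))) fun o _ => ?_).trans_eq
    (by rw [nsmul_eq_mul, Finset.card_univ])
  by_cases ho : o ∈ {o | ∃ o', w o + d ≤ w o'}
  · rw [Set.indicator_of_mem ho, Pi.one_apply, mul_one, softmax_apply]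
    obtain ⟨o', ho'⟩ := ho
    refine ENNReal.ofReal_le_ofReal ?_
    rw [div_le_iff₀ (sum_exp_pos w)]
    calc Real.exp (w o) ≤ Real.exp (-d) * Real.exp (w o') := by
          rw [← Real.exp_add]
          exact Real.exp_le_exp.2 (by linarith)
      _ ≤ _ := by
          gcongr
          exact Finset.single_le_sum (f := fun o => Real.exp (w o))
            (fun o _ => (Real.exp_pos _).le) (Finset.mem_univ o')
  · rw [Set.indicator_of_notMem ho, mul_zero]
    exact zero_le

/-- The exponential mechanism is stable under small changes of the weights. -/
theorem softmax_ratio_le (w w' : O → ℝ) (d : ℝ) (hw : ∀ o, |w o - w' o| ≤ d) (o : O) :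
    Real.exp (w o) / ∑ o', Real.exp (w o') ≤
      Real.exp (2 * d) * (Real.exp (w' o) / ∑ o', Real.exp (w' o')) := by
  have h1 : Real.exp (w o) ≤ Real.exp d * Real.exp (w' o) := by
    rw [← Real.exp_add]
    exact Real.exp_le_exp.2 (by linarith [le_abs_self (w o - w' o), hw o])
  have h2 : ∑ o', Real.exp (w' o') ≤ Real.exp d * ∑ o', Real.exp (w o') := by
    rw [Finset.mul_sum]
    refine Finset.sum_le_sum fun o _ => ?_
    rw [← Real.exp_add]
    exact Real.exp_le_exp.2 (by linarith [neg_abs_le (w o - w' o), hw o])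
  have e : Real.exp (2 * d) = Real.exp d * Real.exp d := by rw [← Real.exp_add]; ring_nf
  rw [← mul_div_assoc, div_le_div_iff₀ (sum_exp_pos w) (sum_exp_pos w'), e]
  calc _ ≤ (Real.exp d * Real.exp (w' o)) * (Real.exp d * ∑ o', Real.exp (w o')) :=
        mul_le_mul h1 h2 (sum_exp_pos w').le (by positivity)
    _ = _ := by ring

theorem softmax_sub_le (w w' : O → ℝ) (d s : ℝ) (hw : ∀ o, |w o - w' o| ≤ d)
    (hs : Real.exp (2 * d) - 1 ≤ s) (o : O) :
    |Real.exp (w o) / ∑ o', Real.exp (w o') - Real.exp (w' o) / ∑ o', Real.exp (w' o')| ≤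
      s * (Real.exp (w' o) / ∑ o', Real.exp (w' o')) := by
  have h1 := softmax_ratio_le w w' d hw o
  have h2 := softmax_ratio_le w' w d (fun o => by rw [abs_sub_comm]; exact hw o) o
  have hd : 0 ≤ d := (abs_nonneg _).trans (hw o)
  have he : 1 ≤ Real.exp (2 * d) := Real.one_le_exp (by linarith)
  set x := Real.exp (w o) / ∑ o', Real.exp (w o')
  set y := Real.exp (w' o) / ∑ o', Real.exp (w' o')
  have hx : 0 ≤ x := div_nonneg (Real.exp_pos _).le (sum_exp_pos w).le
  have hy : 0 ≤ y := div_nonneg (Real.exp_pos _).le (sum_exp_pos w').le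
  rw [abs_le]
  constructor
  · rcases le_total y x with hxy | hxy
    · nlinarith
    · nlinarith [mul_nonneg (sub_nonneg.2 he) (sub_nonneg.2 hxy)]
  · nlinarith

end Softmax

/-- The second moment of the likelihood ratio of two nearby distributions exceeds `1` by at most a
multiple of the probability that an outcome other than `none` occurs. -/
theorem sum_sq_div_potential_le {ι : Type*} [Fintype ι] (p q : Option ι → ℝ) (s : ℝ)
    (hs0 : 0 ≤ s) (hs : s ≤ 1 / 4) (hq : ∀ o, 0 < q o) (hp1 : ∑ o, p o = 1) (hq1 : ∑ o, q o = 1)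
    (hpq : ∀ o, |p o - q o| ≤ s * q o) :
    p none ^ 2 / q none * (1 + 6 * s ^ 2) + ∑ i, p (some i) ^ 2 / q (some i) ≤ 1 + 6 * s ^ 2 := by
  rw [Fintype.sum_option] at hp1 hq1
  have hsome : ∑ i, p (some i) ^ 2 / q (some i) ≤
      ∑ i, (q (some i) + 2 * (p (some i) - q (some i)) + s ^ 2 * q (some i)) := by
    refine Finset.sum_le_sum fun i _ => ?_
    rw [div_le_iff₀ (hq _)]
    have := sq_le_sq' (by linarith [(abs_le.1 (hpq (some i))).1]) (abs_le.1 (hpq (some i))).2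
    nlinarith
  rw [Finset.sum_add_distrib, Finset.sum_add_distrib, ← Finset.mul_sum, ← Finset.mul_sum,
    Finset.sum_sub_distrib] at hsome
  -- Both distributions have mass one, so the deviation at `none` is minus the total deviation
  -- elsewhere. This bound is proportional to the probability of a change, which is why quiet rounds
  -- are almost free.
  have hd : |p none - q none| ≤ s * (1 - q none) := by
    have e : p none - q none = ∑ i, (q (some i) - p (some i)) := by
      rw [Finset.sum_sub_distrib]; linarith
    have e' : s * (1 - q none) = ∑ i, s * q (some i) := by
      rw [← Finset.mul_sum, ← hq1]; ring
    rw [e, e']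
    refine (Finset.abs_sum_le_sum_abs _ _).trans (Finset.sum_le_sum fun i _ => ?_)
    rw [abs_sub_comm]
    exact hpq _
  -- Expanding `p = q + (p - q)`, the square of the deviation is estimated by the product of the two
  -- bounds `s * q none` and `s * (1 - q none)`.
  have hnone : p none ^ 2 / q none ≤
      q none + 2 * (p none - q none) + s ^ 2 * (1 - q none) := by
    rw [div_le_iff₀ (hq _)]
    have h := mul_le_mul (hpq none) hd (abs_nonneg _) (mul_nonneg hs0 (hq none).le)
    rw [abs_mul_abs_self] at h
    nlinarith
  have hp' : 0 ≤ 1 - q none := by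
    rw [← hq1, add_sub_cancel_left]
    exact Finset.sum_nonneg fun i _ => (hq _).le
  have hS : ∑ i, q (some i) = 1 - q none := by linarith
  have hS' : ∑ i, p (some i) = 1 - p none := by linarith
  rw [hS, hS'] at hsome
  have hd2 := (abs_le.1 hd).2
  set x := 1 - q none
  set d := p none - q none
  have hdx : d ≤ x / 4 := hd2.trans (by nlinarith)
  have h1 : 1 - p none - x = -d := by simp only [x, d]; ring
  have h2 : q none = 1 - x := by simp only [x]; ring
  rw [h1] at hsome
  rw [h2] at hnone
  have hs2 : s ^ 2 ≤ 1 / 16 := by nlinarith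
  have hs2' : 0 ≤ s ^ 2 := sq_nonneg s
  have := mul_le_mul_of_nonneg_right hnone (show 0 ≤ 1 + 6 * s ^ 2 by positivity)
  rw [h2]
  nlinarith [mul_nonneg hs2' hp', mul_nonneg (mul_nonneg hs2' hp') (sub_nonneg.2 hs2),
    mul_nonneg hs2' (sub_nonneg.2 hdx)]

/-! ### The update mechanism and its two potentials -/

section Mechanism

variable {k M N : ℕ}

/-- The number of estimates that the value `y` approximates within a factor `1 ± θ`. -/
noncomputable def consistentCount (θ y : ℝ) (z : Fin k → ℝ) : ℕ :=
  (Finset.univ.filter fun j => |y - z j| ≤ θ * |z j|).card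

theorem consistentCount_le_add (θ y : ℝ) {z z' : Fin k → ℝ} {J : Finset (Fin k)}
    (h : ∀ j ∉ J, z j = z' j) : consistentCount θ y z ≤ consistentCount θ y z' + J.card := by
  classical
  refine (Finset.card_le_card fun j hj => ?_).trans (Finset.card_union_le _ _)
  rw [Finset.mem_union, or_iff_not_imp_right]
  intro hJ
  simpa [h j hJ] using hj

/-- The score of keeping the current value, and of every possible new value; a new value has to be
more precise to score, and its score is capped. -/
noncomputable def updateScore (grid : Fin M → ℝ) (α : ℝ) (cap : ℕ) (y : ℝ) (z : Fin k → ℝ) :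
    Option (Fin M) → ℕ
  | none => consistentCount (3 / 4 * α) y z
  | some i => min (consistentCount (α / 4) (grid i) z) cap

theorem updateScore_le_add (grid : Fin M → ℝ) (α : ℝ) (cap : ℕ) (y : ℝ) {z z' : Fin k → ℝ}
    {J : Finset (Fin k)} (h : ∀ j ∉ J, z j = z' j) (o : Option (Fin M)) :
    updateScore grid α cap y z o ≤ updateScore grid α cap y z' o + J.card := by
  cases o with
  | none => exact consistentCount_le_add _ _ h
  | some i =>
    have := consistentCount_le_add (α / 4) (grid i) h
    simp only [updateScore]
    omega

/-- The control state of the robust algorithm: the index of the current value and the number of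
changes. The last number of changes is a dead end. -/
abbrev Control (M N : ℕ) : Type := Fin M × Fin (N + 1)

/-- Keep the current value, or change it. -/
def Control.next (v : Control M N) : Option (Fin M) → Control M N
  | none => v
  | some i => (i, ⟨min (v.2 + 1) N, by omega⟩)

/-- The mechanism of the robust algorithm. -/
noncomputable def updateMechanism (grid : Fin M → ℝ) (α : ℝ) (cap : ℕ) (ε : ℝ) (v : Control M N)
    (z : Fin k → ℝ) : PMF (Option (Fin M)) :=
  if (v.2 : ℕ) < N then softmax fun o => ε * updateScore grid α cap (grid v.1) z o
  else PMF.pure none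

/-- A data-independent guess of what the robust algorithm does in one of `m` rounds. -/
noncomputable def guessUpdate (m M : ℕ) (hM : 0 < M) : PMF (Option (Fin M)) :=
  PMF.ofFintype (fun o => o.elim (m / (m + 1) : ℝ≥0∞) fun _ => ((m + 1) * M : ℝ≥0∞)⁻¹) (by
    have hM' : (M : ℝ≥0∞) ≠ 0 := by exact_mod_cast hM.ne'
    rw [Fintype.sum_option]
    simp only [Option.elim, Finset.sum_const, Finset.card_univ, Fintype.card_fin, nsmul_eq_mul]
    rw [ENNReal.mul_inv (by simp) (by simp), mul_left_comm,
      ENNReal.mul_inv_cancel hM' (ENNReal.natCast_ne_top M), mul_one, ← one_div,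
      ENNReal.div_add_div_same]
    exact ENNReal.div_self (by simp) (by finiteness))

theorem mul_self_div_mul_le {p q c d : ℝ≥0∞} (hp : p ≤ 1) (h : q⁻¹ * c ≤ d) :
    p ^ 2 / q * c ≤ p * d := by
  rw [div_eq_mul_inv, mul_assoc, sq]
  calc p * p * (q⁻¹ * c) ≤ p * 1 * d := by gcongr
    _ = p * d := by rw [mul_one]

/-- Since `p ≤ 1`, the term `p ^ 2 / q` is at most `p / q`. So each outcome may be charged the
inverse of its guessed probability: a quiet round costs `(m + 1) / m`, and a change costs `(m + 1) *
M` and uses up one unit of the budget `N`. In the dead end both mechanisms are deterministic and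
agree. -/
theorem guess_potential (mech : Control M N → (Fin k → ℝ) → PMF (Option (Fin M)))
    (hmech : ∀ v z, ¬ (v.2 : ℕ) < N → mech v z = PMF.pure none) (m : ℕ) (hm : 0 < m) (hM : 0 < M)
    (r : ℕ) (v : Control M N) (z : Fin k → ℝ) :
    ∑ o, mech v z o ^ 2 / (if (v.2 : ℕ) < N then guessUpdate m M hM else PMF.pure none) o *
      (((m + 1) / m : ℝ≥0∞) ^ r * ((m + 1) * M) ^ (N - ((v.next o).2 : ℕ))) ≤
    ((m + 1) / m : ℝ≥0∞) ^ (r + 1) * ((m + 1) * M) ^ (N - (v.2 : ℕ)) := by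
  have hm' : (m : ℝ≥0∞) ≠ 0 := by exact_mod_cast hm.ne'
  have hratio : (1 : ℝ≥0∞) ≤ (m + 1) / m := by
    rw [ENNReal.le_div_iff_mul_le (Or.inl hm') (Or.inl (ENNReal.natCast_ne_top m)), one_mul]
    exact le_self_add
  set D := ((m + 1) / m : ℝ≥0∞) ^ (r + 1) * ((m + 1) * M) ^ (N - (v.2 : ℕ)) with hD
  split_ifs with hv
  · calc _ ≤ ∑ o, mech v z o * D := by
          refine Finset.sum_le_sum fun o _ => mul_self_div_mul_le (PMF.coe_le_one _ _) ?_
          cases o with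
          | none =>
            have : (guessUpdate m M hM) none = (m / (m + 1) : ℝ≥0∞) := rfl
            rw [this, ENNReal.inv_div (Or.inl (by finiteness)) (Or.inl (by simp)), ← mul_assoc,
              ← pow_succ']
            rfl
          | some i =>
            have : (guessUpdate m M hM) (some i) = ((m + 1) * M : ℝ≥0∞)⁻¹ := rfl
            rw [this, inv_inv, mul_left_comm, ← pow_succ',
              show N - ((v.next (some i)).2 : ℕ) + 1 = N - (v.2 : ℕ) by
                simp only [Control.next]; omega, hD, pow_succ]
            gcongr
            exact le_mul_of_one_le_right' hratio
      _ = D := by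
          rw [← Finset.sum_mul, ← tsum_fintype (L := .unconditional _), PMF.tsum_coe, one_mul]
  · rw [hmech v z hv, Fintype.sum_option]
    simp only [PMF.pure_apply, Control.next]
    simp only [if_true, reduceCtorEq, if_false]
    simp only [one_pow, ENNReal.div_self one_ne_zero ENNReal.one_ne_top, one_mul, ne_eq,
      OfNat.ofNat_ne_zero, not_false_eq_true, zero_pow, ENNReal.zero_div, zero_mul,
      Finset.sum_const_zero, add_zero]
    rw [hD, pow_succ]
    gcongr
    exact le_mul_of_one_le_right' hratio

/-- Altering the estimates of the copies in `J` moves each score by at most `J.card`, so the two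
softmax distributions are pointwise within a factor `1 ± s`. By `sum_sq_div_potential_le` the excess
of the second moment is paid by the factor `1 + 6 * s ^ 2` that a change releases, whatever the
number of quiet rounds. -/
theorem updateMechanism_potential (grid : Fin M → ℝ) (α : ℝ) (cap : ℕ) (ε s : ℝ) (hε : 0 ≤ ε)
    (hs : s ≤ 1 / 4) (J : Finset (Fin k)) (hs' : Real.exp (2 * (J.card * ε)) - 1 ≤ s)
    (v : Control M N) (z z' : Fin k → ℝ) (h : ∀ j ∉ J, z j = z' j) :
    ∑ o, updateMechanism grid α cap ε v z o ^ 2 / updateMechanism grid α cap ε v z' o *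
      ENNReal.ofReal ((1 + 6 * s ^ 2) ^ (N - ((v.next o).2 : ℕ))) ≤
    ENNReal.ofReal ((1 + 6 * s ^ 2) ^ (N - (v.2 : ℕ))) := by
  have hs0 : 0 ≤ s := by
    have := Real.one_le_exp (x := 2 * (J.card * ε)) (by positivity)
    linarith
  have hρ : 0 < 1 + 6 * s ^ 2 := by positivity
  unfold updateMechanism
  split_ifs with hv
  · set w := fun o => ε * (updateScore grid α cap (grid v.1) z o : ℝ)
    set w' := fun o => ε * (updateScore grid α cap (grid v.1) z' o : ℝ)
    have hw : ∀ o, |w o - w' o| ≤ J.card * ε := by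
      intro o
      have h1 : (updateScore grid α cap (grid v.1) z o : ℝ) ≤
          updateScore grid α cap (grid v.1) z' o + J.card := by
        exact_mod_cast updateScore_le_add grid α cap (grid v.1) h o
      have h2 : (updateScore grid α cap (grid v.1) z' o : ℝ) ≤
          updateScore grid α cap (grid v.1) z o + J.card := by
        exact_mod_cast updateScore_le_add grid α cap (grid v.1) (fun j hj => (h j hj).symm) o
      simp only [w, w', ← mul_sub]
      rw [abs_mul, abs_of_nonneg hε, mul_comm]
      gcongr
      rw [abs_le]
      constructor <;> linarith
    set p := fun o => Real.exp (w o) / ∑ o', Real.exp (w o')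
    set p' := fun o => Real.exp (w' o) / ∑ o', Real.exp (w' o')
    have hp'0 : ∀ o, 0 < p' o := fun o => div_pos (Real.exp_pos _) (sum_exp_pos w')
    have hp0 : ∀ o, 0 < p o := fun o => div_pos (Real.exp_pos _) (sum_exp_pos w)
    have key := sum_sq_div_potential_le p p' s hs0 hs hp'0
      (by simp only [p]; rw [← Finset.sum_div, div_self (sum_exp_pos w).ne'])
      (by simp only [p']; rw [← Finset.sum_div, div_self (sum_exp_pos w').ne'])
      (softmax_sub_le w w' _ s hw hs')
    have hterm : ∀ o c, 0 ≤ c → softmax w o ^ 2 / softmax w' o * ENNReal.ofReal c =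
        ENNReal.ofReal (p o ^ 2 / p' o * c) := by
      intro o c hc
      rw [softmax_apply, softmax_apply, ← ENNReal.ofReal_pow (hp0 o).le,
        ← ENNReal.ofReal_div_of_pos (hp'0 o), ← ENNReal.ofReal_mul]
      exact div_nonneg (sq_nonneg _) (hp'0 o).le
    simp only [hterm _ _ (pow_nonneg hρ.le _)]
    rw [← ENNReal.ofReal_sum_of_nonneg fun o _ =>
      mul_nonneg (div_nonneg (sq_nonneg _) (hp'0 o).le) (pow_nonneg hρ.le _)]
    refine ENNReal.ofReal_le_ofReal ?_
    rw [Fintype.sum_option]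
    have hN : N - (v.2 : ℕ) = N - min ((v.2 : ℕ) + 1) N + 1 := by omega
    simp only [Control.next]
    rw [← Finset.sum_mul, hN, pow_succ (1 + 6 * s ^ 2)]
    have := mul_le_mul_of_nonneg_left key (pow_nonneg hρ.le (N - min ((v.2 : ℕ) + 1) N))
    linarith
  · rw [Fintype.sum_option]
    simp only [PMF.pure_apply, Control.next]
    simp only [if_true, reduceCtorEq, if_false]
    simp

end Mechanism

/-! ### Error arithmetic for published values -/

section Approximation

variable {α y z γ γ' : ℝ}

/-- Agreement with one accurate estimate transfers to `g`. The mechanism uses `θ = 3 / 4`, which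
gives `37 / 40 < 1` for a kept value, and `θ = 1 / 4`, which gives exactly `3 / 8` for a new one. -/
theorem abs_sub_le_of_consistent {θ : ℝ} (hα : 0 ≤ α) (hα1 : α ≤ 1) (hθ : 0 ≤ θ)
    (h : |y - z| ≤ θ * α * |z|) (hz : |z - γ| ≤ α / 10 * |γ|) :
    |y - γ| ≤ (θ * 11 / 10 + 1 / 10) * α * |γ| := by
  have h1 : |z| ≤ 11 / 10 * |γ| := by
    have := abs_sub_abs_le_abs_sub z γ
    nlinarith [abs_nonneg γ]
  have h2 : |y - γ| ≤ |y - z| + |z - γ| := abs_sub_le y z γ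
  have h3 := mul_le_mul_of_nonneg_left h1 (mul_nonneg hθ hα)
  nlinarith

theorem abs_le_of_approx (hα1 : α ≤ 1) (hz : |z - γ| ≤ α / 10 * |γ|) :
    9 / 10 * |γ| ≤ |z| := by
  have := abs_sub_abs_le_abs_sub γ z
  rw [abs_sub_comm] at this
  nlinarith [abs_nonneg γ]

theorem consistent_of_approx (hα : 0 ≤ α) (hα1 : α ≤ 1) (hy : |y - γ| ≤ α / 10 * |γ|)
    (hz : |z - γ| ≤ α / 10 * |γ|) : |y - z| ≤ α / 4 * |z| := by
  have h1 := abs_le_of_approx hα1 hz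
  have h2 : |y - z| ≤ |y - γ| + |γ - z| := abs_sub_le y γ z
  rw [abs_sub_comm γ z] at h2
  nlinarith [mul_le_mul_of_nonneg_left h1 hα, mul_nonneg hα (abs_nonneg γ)]

/-- A value adopted with precision `3 / 8 * α` still agrees with every accurate estimate as long as
`g` has not flipped since. The gap between the thresholds `α / 4` for adoption and `3 / 4 * α` for
keeping makes room for this. -/
theorem consistent_of_not_flip (hα : 0 ≤ α) (hα1 : α ≤ 1) (hy : |y - γ| ≤ 3 / 8 * α * |γ|)
    (hγ : |γ' - γ| ≤ α / 10 * |γ|) (hz : |z - γ'| ≤ α / 10 * |γ'|) :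
    |y - z| ≤ 3 / 4 * α * |z| := by
  have h1 := abs_le_of_approx hα1 hz
  have h2 := abs_le_of_approx hα1 hγ
  have h3 : |y - z| ≤ |y - γ| + |γ - γ'| + |γ' - z| :=
    (abs_sub_le y γ' z).trans (add_le_add (abs_sub_le y γ γ') le_rfl)
  rw [abs_sub_comm γ' z, abs_sub_comm γ γ'] at h3
  have h4 := mul_le_mul_of_nonneg_left h1 hα
  have h5 := mul_le_mul_of_nonneg_left h2 hα
  nlinarith [mul_nonneg hα (abs_nonneg z)]

end Approximation

/-! ### Transcripts and flips -/

namespace Transcript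

variable {n : ℕ}

theorem stream_append (h h' : Transcript n) : stream (h ++ h') = h.stream ++ h'.stream :=
  List.map_append

theorem length_stream (h : Transcript n) : h.stream.length = h.length := List.length_map _

theorem accurate_append_singleton (g : UpdateStream n → ℝ) (α : ℝ) (h : Transcript n)
    (u : Update n) (z : ℝ) :
    Accurate g α (h ++ [(u, z)]) ↔
      h.Accurate g α ∧ |z - g (h.stream ++ [u])| ≤ α * |g (h.stream ++ [u])| := by
  have hs : stream (h ++ [(u, z)]) = h.stream ++ [u] := stream_append _ _
  have ht : ∀ i < h.length, (h.stream ++ [u]).take (i + 1) = h.stream.take (i + 1) := fun i hi =>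
    List.take_append_of_le_length (by rw [length_stream]; omega)
  constructor
  · intro H
    constructor
    · intro i hi
      have := H i (by simp; omega)
      rwa [hs, ht i hi, List.getElem_append_left hi] at this
    · have := H h.length (by simp)
      rw [hs, List.take_of_length_le (by simp [length_stream])] at this
      simpa using this
  · rintro ⟨H1, H2⟩ i hi
    rw [hs]
    rcases Nat.lt_or_ge i h.length with hi' | hi'
    · rw [ht i hi', List.getElem_append_left hi']
      exact H1 i hi'
    · have : i = h.length := by simp at hi; omega
      subst this
      rw [List.take_of_length_le (by simp [length_stream])]
      simpa using H2

end Transcript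

section Flips

variable {n : ℕ}

/-- There are times at which `g` flips `d` times on the stream `us`, and `y` approximates the value
of `g` at the last of them. -/
def FlipWitness (g : UpdateStream n → ℝ) (α y : ℝ) (us : UpdateStream n) (d : ℕ) : Prop :=
  ∃ t : ℕ → ℕ, (∀ j < d, t j < t (j + 1)) ∧ (∀ j ≤ d, t j ≤ us.length) ∧
    (∀ j < d, α / 10 * |g (us.take (t j))| < |g (us.take (t (j + 1))) - g (us.take (t j))|) ∧
    |y - g (us.take (t d))| ≤ 3 / 8 * α * |g (us.take (t d))|

theorem FlipWitness.append {g : UpdateStream n → ℝ} {α y : ℝ} {us : UpdateStream n} {d : ℕ}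
    (h : FlipWitness g α y us d) (us' : UpdateStream n) : FlipWitness g α y (us ++ us') d := by
  obtain ⟨t, h1, h2, h3, h4⟩ := h
  have ht : ∀ j ≤ d, (us ++ us').take (t j) = us.take (t j) := fun j hj =>
    List.take_append_of_le_length (h2 j hj)
  refine ⟨t, h1, fun j hj => (h2 j hj).trans (by simp), fun j hj => ?_, ?_⟩
  · rw [ht j hj.le, ht (j + 1) hj]
    exact h3 j hj
  · rw [ht d le_rfl]
    exact h4

theorem FlipWitness.single {g : UpdateStream n → ℝ} {α y : ℝ} {us : UpdateStream n}
    (h : |y - g us| ≤ 3 / 8 * α * |g us|) : FlipWitness g α y us 0 :=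
  ⟨fun _ => us.length, by simp, by simp, by simp, by simpa using h⟩

/-- The hypothesis `hflip` quantifies over all values that `y` approximates, so it applies to `g` at
the last recorded time without that time being known. -/
theorem FlipWitness.concat {g : UpdateStream n → ℝ} {α y y' : ℝ} {us : UpdateStream n} {d : ℕ}
    (h : FlipWitness g α y us d) (u : Update n)
    (hy' : |y' - g (us ++ [u])| ≤ 3 / 8 * α * |g (us ++ [u])|)
    (hflip : ∀ γ, |y - γ| ≤ 3 / 8 * α * |γ| → α / 10 * |γ| < |g (us ++ [u]) - γ|) :
    FlipWitness g α y' (us ++ [u]) (d + 1) := by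
  obtain ⟨t, h1, h2, h3, h4⟩ := h
  have ht : ∀ j ≤ d, (us ++ [u]).take (t j) = us.take (t j) := fun j hj =>
    List.take_append_of_le_length (h2 j hj)
  have hlast : (us ++ [u]).take (us.length + 1) = us ++ [u] :=
    List.take_of_length_le (by simp)
  refine ⟨fun j => if j ≤ d then t j else us.length + 1, fun j hj => ?_, fun j hj => ?_,
    fun j hj => ?_, ?_⟩
  · rcases Nat.lt_or_ge j d with hjd | hjd
    · simpa [hjd.le, hjd] using h1 j hjd
    · have : j = d := by omega
      subst this
      have := h2 j le_rfl
      simp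
      omega
  · rcases Nat.lt_or_ge d j with hjd | hjd
    · simp [hjd.not_ge]
    · have := h2 j hjd
      simp [hjd]
      omega
  · rcases Nat.lt_or_ge j d with hjd | hjd
    · simpa [hjd.le, hjd, ht j hjd.le, ht (j + 1) hjd] using h3 j hjd
    · have : j = d := by omega
      subst this
      simpa [ht j le_rfl, hlast] using hflip _ h4
  · simpa [hlast] using hy'

theorem le_last_of_strictMono {d : ℕ} {t : Fin (d + 1) → ℕ} (ht : StrictMono t) :
    d ≤ t (Fin.last d) := by
  have hle : ∀ j : Fin (d + 1), (j : ℕ) ≤ t j := fun j => by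
    induction j using Fin.induction with
    | zero => simp
    | succ i ih =>
      have := ht (Fin.castSucc_lt_succ (i := i))
      simp at ih ⊢
      omega
  simpa using hle (Fin.last d)

theorem FlipWitness.le_flipNumber {g : UpdateStream n → ℝ} {α y : ℝ} {us : UpdateStream n} {d : ℕ}
    (h : FlipWitness g α y us d) {𝒮 : Set (UpdateStream n)} {us' : UpdateStream n} (hus' : us' ∈ 𝒮)
    (hpre : us <+: us') : d ≤ flipNumber g 𝒮 (α / 10) us'.length := by
  obtain ⟨us'', rfl⟩ := hpre
  obtain ⟨t, h1, h2, h3, -⟩ := h.append us''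
  refine le_csSup ⟨(us ++ us'').length, ?_⟩
    ⟨_, hus', rfl, fun j => t j, ?_, fun j => h2 j (by omega), fun j => h3 j j.2⟩
  · rintro e ⟨_, -, -, t, ht, htm, -⟩
    exact (le_last_of_strictMono ht).trans (htm _)
  · exact Fin.strictMono_iff_lt_succ.2 fun j => h1 j j.2

theorem flipNumber_le (g : UpdateStream n → ℝ) (𝒮 : Set (UpdateStream n)) (ε : ℝ) (m : ℕ) :
    flipNumber g 𝒮 ε m ≤ m := by
  refine csSup_le' ?_
  rintro e ⟨_, -, -, t, ht, htm, -⟩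
  exact (le_last_of_strictMono ht).trans (htm _)

end Flips

/-! ### Correctness as long as few copies fail and the mechanism does not err -/

section Correctness

variable {n k M N : ℕ} {S : Type*}

/-- The number of copies whose recorded execution has not been accurate. -/
noncomputable def badCount (g : UpdateStream n → ℝ) (α : ℝ) (x : Fin k → S × Transcript n) : ℕ :=
  failCount {h : Transcript n | ¬ h.Accurate g (α / 10)} x

/-- The invariant of the robust algorithm: it has been accurate, and each of its changes except the
first one is due to a flip, unless many copies have failed. -/
def RobustInvariant (g : UpdateStream n → ℝ) (𝒮 : Set (UpdateStream n)) (α : ℝ) (m K : ℕ)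
    (grid : Fin M → ℝ) (s : (Fin k → S × Transcript n) × Control M N) (h : Transcript n) : Prop :=
  (∀ j, (s.1 j).2.stream = h.stream) ∧
    ((∃ us ∈ 𝒮, us.length = m ∧ h.stream <+: us) → badCount g α s.1 < 8 * K →
      h.Accurate g α ∧ ((s.2.2 : ℕ) = 0 ∨
        ∃ d, (s.2.2 : ℕ) = d + 1 ∧ FlipWitness g α (grid s.2.1) h.stream d))

theorem exists_good_of_lt_card {g : UpdateStream n → ℝ} {α : ℝ} {x : Fin k → S × Transcript n}
    {F : Finset (Fin k)} (h : badCount g α x < F.card) :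
    ∃ j ∈ F, (x j).2.Accurate g (α / 10) := by
  rw [badCount, failCount] at h
  obtain ⟨j, hj, hj'⟩ := Finset.exists_mem_notMem_of_card_lt_card h
  exact ⟨j, hj, by simpa using hj'⟩

theorem badCount_mono {g : UpdateStream n → ℝ} {α : ℝ} {x x' : Fin k → S × Transcript n}
    (h : ∀ j, (x' j).2.Accurate g (α / 10) → (x j).2.Accurate g (α / 10)) :
    badCount g α x ≤ badCount g α x' := by
  rw [badCount, failCount, badCount, failCount]
  refine Finset.card_le_card fun j hj => ?_
  simp only [Finset.mem_filter, Finset.mem_univ, true_and, Set.mem_ofPred_eq] at hj ⊢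
  exact fun hj' => hj (h j hj')

/-- The invariant is preserved when the mechanism does not err. -/
theorem RobustInvariant.step {g : UpdateStream n → ℝ} {𝒮 : Set (UpdateStream n)} {α : ℝ} {m K : ℕ}
    {grid : Fin M → ℝ} {s : (Fin (20 * K) → S × Transcript n) × Control M N} {h : Transcript n}
    (hinv : RobustInvariant g 𝒮 α m K grid s h) (hα : 0 ≤ α) (hα1 : α ≤ 1)
    (hN : flipNumber g 𝒮 (α / 10) m + 2 ≤ N)
    (hgrid : ∀ us ∈ 𝒮, us.length = m → ∀ p, p ≠ [] → p <+: us →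
      ∃ i, |grid i - g p| ≤ α / 10 * |g p|)
    (u : Update n) (a : Fin (20 * K) → (S × Transcript n) × ℝ)
    (ha : ∀ j, (a j).1.2 = (s.1 j).2 ++ [(u, (a j).2)]) (o : Option (Fin M))
    (ho : (s.2.2 : ℕ) < N → ∀ o', updateScore grid α (10 * K) (grid s.2.1) (fun j => (a j).2) o' <
      updateScore grid α (10 * K) (grid s.2.1) (fun j => (a j).2) o + K) :
    RobustInvariant g 𝒮 α m K grid (fun j => (a j).1, s.2.next o)
      (h ++ [(u, grid (s.2.next o).1)]) := by
  obtain ⟨⟨x, v⟩, hs⟩ : ∃ s', s' = s := ⟨s, rfl⟩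
  subst hs
  obtain ⟨hstream, hacc⟩ := hinv
  simp only at hstream hacc ha ho ⊢
  have hst : ∀ z, Transcript.stream (h ++ [(u, z)]) = h.stream ++ [u] := fun z =>
    Transcript.stream_append _ _
  refine ⟨fun j => by rw [ha, Transcript.stream_append, hstream, hst]; rfl, ?_⟩
  rw [hst]
  rintro ⟨us, hus, hlen, hpre⟩ hbad
  have haccj : ∀ j, (a j).1.2.Accurate g (α / 10) ↔ (x j).2.Accurate g (α / 10) ∧
      |(a j).2 - g (h.stream ++ [u])| ≤ α / 10 * |g (h.stream ++ [u])| := fun j => by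
    rw [ha, Transcript.accurate_append_singleton, hstream]
  -- Failures and a broken promise are irrevocable, so the premises of the invariant held before
  -- this round as well.
  have hbad' : badCount g α x < 8 * K :=
    (badCount_mono fun j hj => ((haccj j).1 hj).1).trans_lt hbad
  have hpre' : h.stream <+: us := (List.prefix_append _ _).trans hpre
  obtain ⟨hA, hflip⟩ := hacc ⟨us, hus, hlen, hpre'⟩ hbad'
  -- All changes but the first are flips, so there are at most flip number plus one of them, and the
  -- budget leaves one more.
  have hvN : (v.2 : ℕ) < N := by
    rcases hflip with h0 | ⟨d, hd, hw⟩
    · omega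
    · have := hw.le_flipNumber hus hpre'
      rw [hlen] at this
      omega
  have ho := ho hvN
  rw [Transcript.accurate_append_singleton]
  set γ := g (h.stream ++ [u]) with hγ
  set z : Fin (20 * K) → ℝ := fun j => (a j).2 with hz
  have hgood : ∀ F : Finset (Fin (20 * K)), 8 * K ≤ F.card →
      ∃ j ∈ F, |z j - γ| ≤ α / 10 * |γ| := fun F hF => by
    obtain ⟨j, hj, hj'⟩ := exists_good_of_lt_card (hbad.trans_le hF)
    exact ⟨j, hj, ((haccj j).1 hj').2⟩
  -- Fewer than `8 * K` of the `20 * K` copies are bad, so a value that agrees with every good copy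
  -- has more than `12 * K` supporters.
  have hmost : ∀ θ y, (∀ j, |z j - γ| ≤ α / 10 * |γ| → |y - z j| ≤ θ * |z j|) →
      12 * K < consistentCount θ y z := by
    intro θ y hy
    by_contra! hcon
    have hcard := Finset.card_filter_add_card_filter_not (s := (Finset.univ : Finset (Fin (20 * K))))
      fun j => |y - z j| ≤ θ * |z j|
    rw [Finset.card_univ, Fintype.card_fin] at hcard
    unfold consistentCount at hcon
    obtain ⟨j, hj, hj'⟩ := hgood (Finset.univ.filter fun j => ¬ |y - z j| ≤ θ * |z j|) (by omega)
    exact (Finset.mem_filter.1 hj).2 (hy j hj')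
  obtain ⟨i₀, hi₀⟩ := hgrid us hus hlen (h.stream ++ [u]) (by simp) hpre
  have hi₀' := hmost (α / 4) (grid i₀) fun j hj => consistent_of_approx hα hα1 hi₀ hj
  have hmax := ho (some i₀)
  simp only [updateScore, min_eq_right (show 10 * K ≤ consistentCount (α / 4) (grid i₀) z by omega)]
    at hmax
  have hex : ∀ θ y, 9 * K < consistentCount θ y z →
      ∃ j, |y - z j| ≤ θ * |z j| ∧ |z j - γ| ≤ α / 10 * |γ| := fun θ y hy => by
    obtain ⟨j, hj, hj'⟩ := hgood _ (show 8 * K ≤ consistentCount θ y z by omega)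
    exact ⟨j, (Finset.mem_filter.1 hj).2, hj'⟩
  cases o with
  | none =>
    simp only [Control.next]
    -- The grid point near `γ` attains the cap `10 * K`. Being chosen, the kept value has more than
    -- `9 * K` supporters, and one of them is good.
    change 10 * K < consistentCount (3 / 4 * α) (grid v.1) z + K at hmax
    obtain ⟨j, hj, hj'⟩ := hex (3 / 4 * α) (grid v.1) (by omega)
    refine ⟨⟨hA, ?_⟩, ?_⟩
    · have := abs_sub_le_of_consistent hα hα1 (by norm_num) hj hj'
      nlinarith [mul_nonneg hα (abs_nonneg γ)]
    · rcases hflip with h0 | ⟨d, hd, hw⟩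
      · exact Or.inl h0
      · exact Or.inr ⟨d, hd, hw.append [u]⟩
  | some i =>
    simp only [Control.next]
    have hnone := ho none
    simp only [updateScore] at hnone hmax
    obtain ⟨j, hj, hj'⟩ := hex (α / 4) (grid i) (by omega)
    have happ := abs_sub_le_of_consistent (θ := 1 / 4) hα hα1 (by norm_num)
      (by convert hj using 2; ring) hj'
    have happ' : |grid i - γ| ≤ 3 / 8 * α * |γ| := by convert happ using 3; norm_num
    refine ⟨⟨hA, ?_⟩, Or.inr ?_⟩
    · nlinarith [mul_nonneg hα (abs_nonneg γ)]
    · rcases hflip with h0 | ⟨d, hd, hw⟩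
      · refine ⟨0, ?_, FlipWitness.single happ'⟩
        simp only [h0]
        omega
      · refine ⟨d + 1, ?_, hw.concat u happ' fun γ' hγ' => ?_⟩
        · omega
        -- Without a flip the old value would score more than `12 * K`. But a new value scores at
        -- most the cap `10 * K`, so it could only be chosen if the old one scored below `11 * K`.
        · by_contra! hcon
          have := hmost (3 / 4 * α) (grid v.1) fun j hj =>
            consistent_of_not_flip hα hα1 hγ' hcon hj
          omega

end Correctness

theorem PMF.expect_indicator_compl_le {α : Type*} (p : PMF α) (s : Set α) {b : ℝ} (hb : b ≤ 1)
    (hb0 : 0 ≤ b) (h : ENNReal.ofReal (1 - b) ≤ p.expect (s.indicator 1)) :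
    p.expect (sᶜ.indicator 1) ≤ ENNReal.ofReal b := by
  have h1 := p.expect_indicator_add_compl s
  have h2 : ENNReal.ofReal (1 - b) + p.expect (sᶜ.indicator 1) ≤
      ENNReal.ofReal (1 - b) + ENNReal.ofReal b := by
    rw [← ENNReal.ofReal_add (by linarith) hb0, sub_add_cancel, ENNReal.ofReal_one, ← h1]
    gcongr
  exact (ENNReal.add_le_add_iff_left ENNReal.ofReal_ne_top).1 h2

theorem PMF.mem_support_pi {α : Type*} {k : ℕ} {p : Fin k → PMF α} {f : Fin k → α}
    (h : f ∈ (PMF.pi p).support) (j : Fin k) : f j ∈ (p j).support := by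
  rw [PMF.mem_support_iff, PMF.pi_apply, Finset.prod_ne_zero_iff] at h
  exact h j (Finset.mem_univ j)

/-! ### The robust algorithm: error probability and space -/

namespace StreamingAlgorithm

variable {n : ℕ} (A : StreamingAlgorithm n) {K M N : ℕ}

theorem eq_append_of_mem_support_recordStep {s : A.State × Transcript n} {u : Update n}
    {p : (A.State × Transcript n) × ℝ} (hp : p ∈ (A.recordStep s u).support) :
    p.1.2 = s.2 ++ [(u, p.2)] := by
  rw [recordStep, PMF.mem_support_map_iff] at hp
  obtain ⟨x, -, rfl⟩ := hp
  rfl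

open Classical in
/-- The probability that the mechanism errs although few copies fail. -/
theorem gameValue_mechanism_error_le {g : UpdateStream n → ℝ} {𝒮 : Set (UpdateStream n)} {α : ℝ}
    {m : ℕ} {grid : Fin M → ℝ} (hα : 0 ≤ α) (hα1 : α ≤ 1) {ε : ℝ} (hε : 0 < ε)
    (hN : flipNumber g 𝒮 (α / 10) m + 2 ≤ N)
    (hgrid : ∀ us ∈ 𝒮, us.length = m → ∀ p, p ≠ [] → p <+: us →
      ∃ i, |grid i - g p| ≤ α / 10 * |g p|)
    (adv : Adversary n) (r : ℕ) (s : (Fin (20 * K) → A.State × Transcript n) × Control M N)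
    (h : Transcript n) (hr : h.length + r = m) (hinv : RobustInvariant g 𝒮 α m K grid s h) :
    gameValue (ensembleStep A.recordStep (updateMechanism grid α (10 * K) ε) Control.next
        fun v => grid v.1) adv
      (fun s h => if h.stream ∈ 𝒮 ∧ badCount g α s.1 < 8 * K ∧ ¬ h.Accurate g α then 1 else 0)
      r s h ≤ r * ENNReal.ofReal ((M + 1) * Real.exp (-(ε * K))) := by
  induction r generalizing s h with
  | zero =>
    simp only [gameValue]
    rw [if_neg]
    · exact zero_le
    · rintro ⟨h1, h2, h3⟩
      exact h3 (hinv.2 ⟨_, h1, by rw [Transcript.length_stream]; omega, List.prefix_refl _⟩ h2).1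
  | succ r ih =>
    simp only [gameValue]
    set ξ := ENNReal.ofReal ((M + 1) * Real.exp (-(ε * K))) with hξ
    refine le_trans (PMF.expect_mono (g := fun _ => ((r + 1 : ℕ) : ℝ≥0∞) * ξ) _ fun u => ?_)
      (PMF.expect_const _ _).le
    simp only [ensembleStep, PMF.expect_bind, PMF.expect_map]
    refine le_trans (PMF.expect_mono_support (g := fun _ => ((r + 1 : ℕ) : ℝ≥0∞) * ξ) _
      fun a ha => ?_) (PMF.expect_const _ _).le
    have ha' : ∀ j, (a j).1.2 = (s.1 j).2 ++ [(u, (a j).2)] := fun j =>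
      A.eq_append_of_mem_support_recordStep (PMF.mem_support_pi ha j)
    have hlen : ∀ z, List.length (h ++ [(u, z)]) + r = m := fun z => by
      rw [List.length_append, List.length_singleton]
      omega
    by_cases hv : (s.2.2 : ℕ) < N
    · rw [updateMechanism, if_pos hv]
      set w : Option (Fin M) → ℝ := fun o =>
        ε * updateScore grid α (10 * K) (grid s.2.1) (fun j => (a j).2) o
      refine le_trans (PMF.expect_mono (g := fun o =>
        {o | ∃ o', w o + ε * K ≤ w o'}.indicator 1 o + r * ξ) _ fun o => ?_) ?_
      · by_cases ho : o ∈ {o | ∃ o', w o + ε * K ≤ w o'}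
        · rw [Set.indicator_of_mem ho]
          refine le_trans (gameValue_le_const (b := 1) _ _ _ _ _ fun _ _ _ _ => ?_) le_self_add
          split_ifs <;> simp
        · rw [Set.indicator_of_notMem ho, zero_add]
          refine ih _ _ (hlen _) (hinv.step hα hα1 hN hgrid u a ha' o fun _ o' => ?_)
          by_contra! hcon
          refine ho ⟨o', ?_⟩
          simp only [w]
          rw [← mul_add]
          exact mul_le_mul_of_nonneg_left (by exact_mod_cast hcon) hε.le
      · rw [PMF.expect_add, PMF.expect_const, Nat.cast_succ, add_mul, one_mul, add_comm]
        gcongr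
        refine (softmax_expect_le w (ε * K)).trans_eq ?_
        rw [hξ, Fintype.card_option, Fintype.card_fin]
        push_cast
        rfl
    -- In the dead end the mechanism has no randomness, and the condition on its choice is vacuous.
    · rw [updateMechanism, if_neg hv, PMF.expect_pure]
      refine (ih _ _ (hlen _) (hinv.step hα hα1 hN hgrid u a ha' none fun hv' =>
        absurd hv' hv)).trans ?_
      gcongr
      exact Nat.le_succ r

/-- The robust algorithm: an ensemble of independent copies of `A`, whose estimates are only
accessed by the exponential mechanism. -/
noncomputable def robust (K : ℕ) (grid : Fin M → ℝ) (α ε : ℝ) (v : Control M N) :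
    StreamingAlgorithm n where
  State := (Fin (20 * K) → A.State) × Control M N
  finite_state := by
    have := A.finite_state
    infer_instance
  start := (PMF.pi fun _ => A.start).map fun s => (s, v)
  step := ensembleStep A.step (updateMechanism grid α (10 * K) ε) Control.next fun v => grid v.1

/-- The records of the copies serve the analysis only and are not stored. Forgetting them commutes
with the transitions, so the game may be analysed with records. -/
theorem expect_play_robust (grid : Fin M → ℝ) (α ε : ℝ) (v : Control M N) (adv : Adversary n)
    (Φ : Transcript n → ℝ≥0∞) (m : ℕ) :
    ((A.robust K grid α ε v).play adv m).expect Φ =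
      (PMF.pi fun _ : Fin (20 * K) => A.start).expect fun s =>
        gameValue (ensembleStep A.recordStep (updateMechanism grid α (10 * K) ε) Control.next
          fun v => grid v.1) adv (fun _ => Φ) m (fun j => (s j, []), v) [] := by
  rw [expect_play]
  simp only [robust, PMF.expect_map]
  congr 1
  funext s
  refine (gameValue_comp (ensembleStep A.recordStep _ _ _) _
    (fun s : (Fin (20 * K) → A.State × Transcript n) × Control M N => (fun j => (s.1 j).1, s.2))
    (fun s u F => ?_) adv (fun _ => Φ) m (fun j => (s j, []), v) []).symm
  simp only [ensembleStep, PMF.expect_bind, PMF.expect_map]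
  have hstep : (fun j => A.step (s.1 j).1 u) = fun j =>
      (A.recordStep (s.1 j) u).map fun p => (p.1.1, p.2) := by
    funext j
    rw [recordStep, PMF.map_comp]
    exact (PMF.map_id _).symm
  rw [hstep, ← PMF.pi_map _ fun _ (p : (A.State × Transcript n) × ℝ) => (p.1.1, p.2),
    PMF.expect_map]

open Classical in
theorem robust_adversariallyRobust {g : UpdateStream n → ℝ} {𝒮 : Set (UpdateStream n)} {α : ℝ}
    {m : ℕ} {grid : Fin M → ℝ} (hα : 0 ≤ α) (hα1 : α ≤ 1) {ε : ℝ} (hε : 0 < ε)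
    (hN : flipNumber g 𝒮 (α / 10) m + 2 ≤ N)
    (hgrid : ∀ us ∈ 𝒮, us.length = m → ∀ p, p ≠ [] → p <+: us →
      ∃ i, |grid i - g p| ≤ α / 10 * |g p|)
    (v : Control M N) (hv : (v.2 : ℕ) = 0) {δ : ℝ} (hδ0 : 0 ≤ δ)
    (hbad : ∀ adv : Adversary n, (PMF.pi fun _ : Fin (20 * K) => A.start).expect (fun s =>
      gameValue (ensembleStep A.recordStep (updateMechanism grid α (10 * K) ε) Control.next
        fun v => grid v.1) adv
        (fun s h => {h : Transcript n | h.stream ∈ 𝒮}.indicator 1 h *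
          if 8 * K ≤ badCount g α s.1 then 1 else 0)
        m (fun j => (s j, []), v) []) ≤ ENNReal.ofReal (δ / 2))
    (herr : m * ((M + 1) * Real.exp (-(ε * K))) ≤ δ / 2) :
    (A.robust K grid α ε v).AdversariallyRobust g 𝒮 m α (1 - δ) := by
  intro adv
  rw [PMF.toOuterMeasure_eq_expect]
  set E := {h : Transcript n | h.stream ∈ 𝒮 → h.Accurate g α}
  set p := (A.robust K grid α ε v).play adv m with hp
  have hfail : p.expect (Eᶜ.indicator 1) ≤ ENNReal.ofReal δ := by
    rw [hp, expect_play_robust]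
    calc _ ≤ (PMF.pi fun _ : Fin (20 * K) => A.start).expect (fun s =>
          gameValue (ensembleStep A.recordStep (updateMechanism grid α (10 * K) ε) Control.next
            fun v => grid v.1) adv
          (fun s h => ({h : Transcript n | h.stream ∈ 𝒮}.indicator 1 h *
            if 8 * K ≤ badCount g α s.1 then 1 else 0) +
            if h.stream ∈ 𝒮 ∧ badCount g α s.1 < 8 * K ∧ ¬ h.Accurate g α then 1 else 0)
          m (fun j => (s j, []), v) []) := by
          refine PMF.expect_mono _ fun s => gameValue_mono _ _ _ _ _ fun s (h : Transcript n) _ _ => ?_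
          by_cases hE : h ∈ Eᶜ
          · have hE' : h.stream ∈ 𝒮 ∧ ¬ h.Accurate g α := by
              simpa [E] using hE
            rw [Set.indicator_of_mem hE, Set.indicator_of_mem (show h ∈
              {h : Transcript n | h.stream ∈ 𝒮} from hE'.1)]
            by_cases hc : badCount g α s.1 < 8 * K
            · rw [if_pos (⟨hE'.1, hc, hE'.2⟩ : _ ∧ _ ∧ _)]
              exact le_add_self
            · rw [if_pos (not_lt.1 hc)]
              simp
          · rw [Set.indicator_of_notMem hE]
            exact zero_le
      _ ≤ ENNReal.ofReal (δ / 2) + ENNReal.ofReal (δ / 2) := by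
          simp only [gameValue_add, PMF.expect_add]
          refine add_le_add (hbad adv) ?_
          refine le_trans (PMF.expect_mono _ fun s => A.gameValue_mechanism_error_le hα hα1 hε hN
            hgrid adv m _ [] (by simp) ⟨fun _ => rfl, fun _ _ => ⟨?_, Or.inl hv⟩⟩) ?_
          · intro i hi
            simp at hi
          · rw [PMF.expect_const, ← ENNReal.ofReal_natCast,
              ← ENNReal.ofReal_mul (Nat.cast_nonneg m)]
            exact ENNReal.ofReal_le_ofReal herr
      _ = ENNReal.ofReal δ := by
          rw [← ENNReal.ofReal_add (by positivity) (by positivity), add_halves]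
  have h1 := p.expect_indicator_add_compl E
  rw [ENNReal.ofReal_sub _ hδ0, ENNReal.ofReal_one, ← h1]
  exact tsub_le_iff_right.2 (by gcongr)

theorem card_state_robust (grid : Fin M → ℝ) (α ε : ℝ) (v : Control M N) :
    Nat.card (A.robust K grid α ε v).State = Nat.card A.State ^ (20 * K) * (M * (N + 1)) := by
  change Nat.card ((Fin (20 * K) → A.State) × Control M N) = _
  have := A.finite_state
  rw [Nat.card_prod, Nat.card_fun, Nat.card_prod]
  simp

theorem space_robust_le (grid : Fin M → ℝ) (α ε : ℝ) (v : Control M N) :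
    (A.robust K grid α ε v).space ≤ 20 * K * A.space + Nat.clog 2 (M * (N + 1)) := by
  rw [space, card_state_robust]
  refine Nat.clog_le_of_le_pow ?_
  rw [pow_add, mul_comm (20 * K), pow_mul 2 A.space]
  exact Nat.mul_le_mul (Nat.pow_le_pow_left (Nat.le_pow_clog one_lt_two _) _)
    (Nat.le_pow_clog one_lt_two _)

end StreamingAlgorithm

/-! ### The value grid and binomial ratios -/

/-- A geometric grid approximates all the numbers of moderate size. -/
theorem exists_geometric_grid {α : ℝ} (hα : 0 < α) (hα1 : α ≤ 1) (R : ℕ) :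
    ∃ M : ℕ, 0 < M ∧ (M : ℝ) ≤ (66 * R + 3) / α ∧ ∃ grid : Fin M → ℝ,
      ∀ γ : ℝ, γ = 0 ∨ (1 / 2 ^ R ≤ |γ| ∧ |γ| ≤ 2 ^ R) → ∃ i, |grid i - γ| ≤ α / 10 * |γ| := by
  set a := ⌈10 / α⌉₊ with ha
  set I := a * R with hI
  set b := 1 + α / 10 with hb
  have hb1 : 1 < b := by rw [hb]; linarith [div_pos hα (by norm_num : (0 : ℝ) < 10)]
  have ha1 : 10 / α ≤ a := Nat.le_ceil _
  have ha2 : (a : ℝ) ≤ 11 / α := by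
    have h1 := (Nat.ceil_lt_add_one (show 0 ≤ 10 / α by positivity)).le
    have h2 : 1 ≤ 1 / α := by rw [le_div_iff₀ hα]; linarith
    have h3 : 11 / α = 10 / α + 1 / α := by ring
    rw [h3]
    exact h1.trans (by linarith)
  have hbI : (2 : ℝ) ^ R ≤ b ^ I := by
    rw [hI, pow_mul]
    gcongr
    calc (2 : ℝ) ≤ 1 + a * (α / 10) := by
          rw [div_le_iff₀ hα] at ha1
          linarith
      _ ≤ b ^ a := one_add_mul_le_pow (by linarith [div_pos hα (by norm_num : (0 : ℝ) < 10)]) a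
  have hcov : ∀ x : ℝ, 1 / 2 ^ R ≤ x → x ≤ 2 ^ R →
      ∃ i : Fin (2 * I + 1), |b ^ ((i : ℤ) - I) - x| ≤ α / 10 * x := by
    intro x hx1 hx2
    have hx0 : 0 < x := lt_of_lt_of_le (by positivity) hx1
    obtain ⟨i, hi1, hi2⟩ := exists_mem_Ico_zpow hx0 hb1
    have h1 : i ≤ I := by
      rw [← zpow_le_zpow_iff_right₀ hb1, zpow_natCast]
      exact hi1.trans (hx2.trans hbI)
    have h2 : -(I : ℤ) < i + 1 := by
      rw [← zpow_lt_zpow_iff_right₀ hb1, zpow_neg, zpow_natCast]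
      refine lt_of_le_of_lt ?_ hi2
      refine le_trans ?_ hx1
      rw [one_div]
      gcongr
    refine ⟨⟨(i + I).toNat, by omega⟩, ?_⟩
    have h3 : (((i + I).toNat : ℕ) : ℤ) - I = i := by omega
    simp only [h3]
    rw [zpow_add_one₀ (by linarith)] at hi2
    have hα' : 0 ≤ α / 10 := by positivity
    rw [abs_sub_comm, abs_of_nonneg (by linarith)]
    nlinarith
  -- The factor `3` encodes the sign: `Fin 3` shifted by one yields `-1`, `0` and `1`. The exponents
  -- run from `-I` to `I`.
  refine ⟨3 * (2 * I + 1), by omega, ?_, fun i =>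
    (((finProdFinEquiv.symm i).1 : ℝ) - 1) * b ^ (((finProdFinEquiv.symm i).2 : ℤ) - I), ?_⟩
  · rw [hI]
    push_cast
    have h2 : 3 ≤ 3 / α := by rw [le_div_iff₀ hα]; linarith
    have h3 : (66 * R + 3) / α = 6 * (11 / α * R) + 3 / α := by ring
    rw [h3]
    have := mul_le_mul_of_nonneg_right ha2 (Nat.cast_nonneg R)
    linarith
  · rintro γ (rfl | ⟨h1, h2⟩)
    · refine ⟨finProdFinEquiv (1, 0), ?_⟩
      simp only [Equiv.symm_apply_apply]
      simp
    · obtain ⟨i, hi⟩ := hcov _ h1 h2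
      rcases le_total 0 γ with hγ | hγ
      · refine ⟨finProdFinEquiv (2, i), ?_⟩
        simp only [Equiv.symm_apply_apply]
        rw [abs_of_nonneg hγ] at hi ⊢
        convert hi using 2
        norm_num
      · refine ⟨finProdFinEquiv (0, i), ?_⟩
        simp only [Equiv.symm_apply_apply]
        rw [abs_of_nonpos hγ] at hi ⊢
        rw [← abs_neg]
        convert hi using 2
        norm_num
        ring

/-- Passing from `q` to `q + 1` multiplies the ratio of the two binomial coefficients by `(k - q) /
(M - q)`, which is at most `k / a`. -/
theorem choose_mul_pow_le {k M a q : ℕ} (h : a + q ≤ M) :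
    k.choose q * a ^ q ≤ M.choose q * k ^ q := by
  induction q with
  | zero => simp
  | succ q ih =>
    have h1 := Nat.choose_succ_right_eq k q
    have h2 := Nat.choose_succ_right_eq M q
    have h3 : (k - q) * a ≤ (M - q) * k := by
      calc (k - q) * a ≤ k * (M - q) := Nat.mul_le_mul (Nat.sub_le _ _) (by omega)
        _ = _ := mul_comm _ _
    refine Nat.le_of_mul_le_mul_right (c := q + 1) ?_ (Nat.succ_pos q)
    calc k.choose (q + 1) * a ^ (q + 1) * (q + 1)
        = (k.choose (q + 1) * (q + 1)) * (a ^ q * a) := by ring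
      _ = (k.choose q * a ^ q) * ((k - q) * a) := by rw [h1]; ring
      _ ≤ (M.choose q * k ^ q) * ((M - q) * k) := Nat.mul_le_mul (ih (by omega)) h3
      _ = (M.choose (q + 1) * (q + 1)) * (k ^ q * k) := by rw [h2]; ring
      _ = _ := by ring

theorem choose_le_choose_mul_pow {K q : ℕ} (hK : 0 < K) (hq : 10 * q ≤ K) :
    ((20 * K).choose q : ℝ) ≤ (8 * K).choose q * (200 / 79) ^ q := by
  have h := choose_mul_pow_le (k := 20 * K) (M := 8 * K) (a := 8 * K - q) (q := q) (by omega)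
  have ha : ((8 * K - q : ℕ) : ℝ) = 8 * K - q := by
    rw [Nat.cast_sub (by omega)]
    push_cast
    ring
  have hq' : (10 : ℝ) * q ≤ K := by exact_mod_cast hq
  have hK' : (0 : ℝ) < K := by exact_mod_cast hK
  have hpos : (0 : ℝ) < 8 * K - q := by linarith
  have h' : ((20 * K).choose q : ℝ) * (8 * K - q) ^ q ≤ (8 * K).choose q * (20 * K : ℝ) ^ q := by
    rw [← ha]
    exact_mod_cast h
  refine le_of_mul_le_mul_right (h'.trans ?_) (pow_pos hpos q)
  rw [mul_assoc, ← mul_pow]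
  exact mul_le_mul_of_nonneg_left (pow_le_pow_left₀ (by positivity) (by linarith) q)
    (Nat.cast_nonneg _)

namespace StreamingAlgorithm

variable {n : ℕ} (A : StreamingAlgorithm n)

theorem stream_of_mem_support_runFrom (us : UpdateStream n) (s : A.State) {h : Transcript n}
    (hh : h ∈ (A.runFrom s us).support) : h.stream = us := by
  induction us generalizing s h with
  | nil =>
    rw [runFrom, PMF.mem_support_pure_iff] at hh
    rw [hh]
    rfl
  | cons u us ih =>
    rw [runFrom, PMF.mem_support_bind_iff] at hh
    obtain ⟨p, -, hp⟩ := hh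
    rw [PMF.mem_support_map_iff] at hp
    obtain ⟨h', hh', rfl⟩ := hp
    exact congrArg (u :: ·) (ih _ hh')

theorem stream_of_mem_support_run {us : UpdateStream n} {h : Transcript n}
    (hh : h ∈ (A.run us).support) : h.stream = us := by
  rw [run, PMF.mem_support_bind_iff] at hh
  obtain ⟨s, -, hs⟩ := hh
  exact A.stream_of_mem_support_runFrom us s hs

variable {A}

theorem ObliviouslyAccurate.expect_le {g : UpdateStream n → ℝ} {𝒮 : Set (UpdateStream n)} {m : ℕ}
    {α : ℝ} (hA : A.ObliviouslyAccurate g 𝒮 m α (9 / 10)) {us : UpdateStream n} (hus : us ∈ 𝒮)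
    (hlen : us.length = m) :
    (A.run us).expect ({h | ¬ h.Accurate g α}.indicator 1) ≤ ENNReal.ofReal (1 / 10) := by
  refine (A.run us).expect_indicator_compl_le {h | h.Accurate g α} (by norm_num) (by norm_num) ?_
  rw [← PMF.toOuterMeasure_eq_expect]
  convert hA us hus hlen using 2
  norm_num

/-- The function that is estimated has moderate values, since the estimates have. -/
theorem ObliviouslyAccurate.value_bounds {g : UpdateStream n → ℝ} {𝒮 : Set (UpdateStream n)}
    {m c : ℕ} {α : ℝ} (hα1 : α ≤ 1)
    (hA : A.ObliviouslyAccurate g 𝒮 m (α / 10) (9 / 10)) (hb : A.EstimatesPolyBounded 𝒮 m c)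
    {us : UpdateStream n} (hus : us ∈ 𝒮) (hlen : us.length = m) {p : UpdateStream n} (hp : p ≠ [])
    (hpre : p <+: us) :
    g p = 0 ∨ (1 / (2 * (n : ℝ) ^ c) ≤ |g p| ∧ |g p| ≤ 2 * (n : ℝ) ^ c) := by
  obtain ⟨h, hacc, hsupp⟩ : ∃ h : Transcript n, h.Accurate g (α / 10) ∧ h ∈ (A.run us).support := by
    by_contra! hcon
    have hle := hA us hus hlen
    have hzero : (A.run us).toOuterMeasure {h | h.Accurate g (α / 10)} = 0 :=
      (PMF.toOuterMeasure_apply_eq_zero_iff _ _).2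
        (Set.disjoint_left.2 fun h h1 h2 => hcon h h2 h1)
    rw [hzero] at hle
    exact absurd hle (by rw [nonpos_iff_eq_zero, ENNReal.ofReal_eq_zero]; norm_num)
  have hst := A.stream_of_mem_support_run hsupp
  have hplen : 0 < p.length := List.length_pos_iff.2 hp
  have hhl : p.length ≤ h.length := by
    rw [← Transcript.length_stream, hst]
    exact hpre.length_le
  have hi : p.length - 1 < h.length := by omega
  have hz := hacc (p.length - 1) hi
  rw [hst, Nat.sub_add_cancel hplen, ← List.prefix_iff_eq_take.1 hpre] at hz
  have hzb := hb us hus hlen h hsupp h[p.length - 1] (List.getElem_mem hi)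
  set z := h[p.length - 1].2
  have h1 := abs_le_of_approx hα1 hz
  have h2 : |z| ≤ 2 * |g p| := by
    have := abs_sub_abs_le_abs_sub z (g p)
    nlinarith [abs_nonneg (g p)]
  rcases hzb with h0 | ⟨hl, hu⟩
  · left
    rw [h0, abs_zero] at h1
    exact abs_eq_zero.1 (le_antisymm (by linarith) (abs_nonneg _))
  · right
    constructor
    · rw [mul_comm, ← div_div]
      linarith
    · linarith

theorem ObliviouslyAccurate.exists_grid {g : UpdateStream n → ℝ} {𝒮 : Set (UpdateStream n)}
    {m c : ℕ} {α : ℝ} (hm : 1 ≤ m) (hnm : Real.log n ≤ c * Real.log m) (hα : 0 < α) (hα1 : α ≤ 1)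
    (hA : A.ObliviouslyAccurate g 𝒮 m (α / 10) (9 / 10)) (hb : A.EstimatesPolyBounded 𝒮 m c) :
    ∃ M : ℕ, 0 < M ∧ (M : ℝ) ≤ 69 * (1 + c ^ 2) * m / α ∧ ∃ grid : Fin M → ℝ,
      ∀ us ∈ 𝒮, us.length = m → ∀ p, p ≠ [] → p <+: us →
        ∃ i, |grid i - g p| ≤ α / 10 * |g p| := by
  -- The values of `g` are at most `2 * n ^ c ≤ 2 * m ^ (c ^ 2)`, and `m ≤ 2 ^ m`. This is crude,
  -- but only the logarithm of `M` enters the space.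
  obtain ⟨M, hM0, hM, grid, hgrid⟩ := exists_geometric_grid hα hα1 (1 + c ^ 2 * m)
  refine ⟨M, hM0, hM.trans ?_, grid, fun us hus hlen p hp hpre => hgrid _ ?_⟩
  · gcongr
    push_cast
    have : (1 : ℝ) ≤ m := by exact_mod_cast hm
    nlinarith [mul_nonneg (sq_nonneg (c : ℝ)) (Nat.cast_nonneg (α := ℝ) m)]
  · refine (hA.value_bounds hα1 hb hus hlen hp hpre).imp_right fun ⟨h1, h2⟩ => ?_
    have hn : 0 < n := by
      obtain ⟨u, -, -⟩ := List.exists_cons_of_ne_nil hp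
      exact u.1.pos
    have hn' : (0 : ℝ) < n := by exact_mod_cast hn
    have hm' : (0 : ℝ) < m := by exact_mod_cast hm
    have hnm' : (n : ℝ) ≤ (m : ℝ) ^ c := by
      rw [← Real.log_le_log_iff hn' (by positivity), Real.log_pow]
      exact hnm
    have hm2 : (m : ℝ) ≤ 2 ^ m := by exact_mod_cast Nat.lt_two_pow_self.le
    have hR : 2 * (n : ℝ) ^ c ≤ 2 ^ (1 + c ^ 2 * m) := by
      calc 2 * (n : ℝ) ^ c ≤ 2 * (((2 : ℝ) ^ m) ^ c) ^ c := by
            gcongr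
            exact hnm'.trans (by gcongr)
        _ = _ := by rw [← pow_mul, ← pow_mul, pow_add, pow_one]; ring_nf
    refine ⟨le_trans ?_ h1, h2.trans hR⟩
    gcongr

end StreamingAlgorithm

theorem pow_le_half_of_log_le {δ : ℝ} (hδ : 0 < δ) (hδ2 : δ ≤ 1 / 2) {q : ℕ}
    (hq : 30 * Real.log (1 / δ) ≤ q) : (93 / 100 : ℝ) ^ q ≤ δ / 2 := by
  have hℓ : 0 ≤ Real.log (1 / δ) := Real.log_nonneg (by rw [le_div_iff₀ hδ]; linarith)
  calc (93 / 100 : ℝ) ^ q ≤ Real.exp (-(7 / 100)) ^ q := by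
        gcongr
        linarith [Real.add_one_le_exp (-(7 / 100 : ℝ))]
    _ = Real.exp (q * -(7 / 100)) := (Real.exp_nat_mul _ _).symm
    _ ≤ Real.exp (2 * Real.log δ) := by
        rw [one_div, Real.log_inv] at hq hℓ
        exact Real.exp_le_exp.2 (by linarith)
    _ = δ ^ 2 := by
        rw [two_mul, Real.exp_add, Real.exp_log hδ, sq]
    _ ≤ δ / 2 := by nlinarith

theorem exp_le_pow (q : ℕ) {x : ℝ} (hx : x ≤ 9 / 100 * q) : Real.exp x ≤ (11 / 10 : ℝ) ^ q := by
  have h1 : (Real.exp (-(9 / 100)))⁻¹ ≤ (11 / 10 : ℝ) := by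
    rw [inv_le_comm₀ (Real.exp_pos _) (by norm_num)]
    linarith [Real.add_one_le_exp (-(9 / 100 : ℝ))]
  rw [← Real.exp_neg, neg_neg] at h1
  calc Real.exp x ≤ Real.exp (q * (9 / 100)) := Real.exp_le_exp.2 (by linarith)
    _ = Real.exp (9 / 100) ^ q := Real.exp_nat_mul _ _
    _ ≤ _ := by gcongr

/-! ### The probability that many copies fail -/

namespace StreamingAlgorithm

variable {n : ℕ} (A : StreamingAlgorithm n) {V O : Type*}

theorem expect_gameValue_many_bad_le [Fintype O] {K q : ℕ} (hK : 0 < K) (hq : 10 * q ≤ K)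
    (mech : V → (Fin (20 * K) → ℝ) → PMF O) (next : V → O → V) (out : V → ℝ) (pot : ℕ → V → ℝ≥0∞)
    (hpot1 : ∀ r v, 1 ≤ pot r v)
    (hpot : ∀ J : Finset (Fin (20 * K)), J.card = q →
      ∃ mechQ : V → (Fin (20 * K) → ℝ) → PMF O, ∀ r v a b,
        ∑ o, mech v (selectOn J a b) o ^ 2 / mechQ v a o * pot r (next v o) ≤ pot (r + 1) v)
    (adv : Adversary n) (ind : Transcript n → ℝ≥0∞) (bad : Set (Transcript n)) (m : ℕ)
    (hind : ∀ h, ind h ≤ 1)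
    (hf : ∀ h : Transcript n, h.length = m → ind h ≠ 0 →
      (A.run h.stream).expect (bad.indicator 1) ≤ ENNReal.ofReal (1 / 10))
    (v : V) (hv : pot m v ≤ ENNReal.ofReal ((11 / 10) ^ q)) :
    (PMF.pi fun _ : Fin (20 * K) => A.start).expect (fun s =>
      gameValue (ensembleStep A.recordStep mech next out) adv
        (fun s h => ind h *
          if 8 * K ≤ failCount bad s.1 then 1 else 0)
        m (fun j => (s j, []), v) []) ≤ ENNReal.ofReal ((93 / 100) ^ q) := by
  have ht : (0 : ℝ) < 3 ^ q := by positivity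
  -- The scale `3 ^ q` balances the two terms: with the binomial ratio `(200 / 79) ^ q` they have
  -- bases `200 / 79 * 3 / 10` and `200 / 79 * 11 / 30`, both below `93 / 100`.
  have hmain := A.expect_gameValue_card_le mech next out q (8 * K) pot hpot1 hpot adv ind bad
    (ENNReal.ofReal (1 / 10)) m hind hf v (ENNReal.ofReal (3 ^ q))
    (by rw [ne_eq, ENNReal.ofReal_eq_zero, not_le]; exact ht) ENNReal.ofReal_ne_top
  set X := (PMF.pi fun _ : Fin (20 * K) => A.start).expect _
  have hchoose : 0 < (8 * K).choose q := Nat.choose_pos (by omega)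
  have hchoose' : (0 : ℝ) < (8 * K).choose q := by exact_mod_cast hchoose
  have hreal : ((20 * K).choose q : ℝ) * (3 ^ q * (1 / 10) ^ q + (3 ^ q)⁻¹ * (11 / 10) ^ q) ≤
      2 * (8 * K).choose q * (93 / 100) ^ q := by
    have h1 : (200 / 79 : ℝ) ^ q * (3 ^ q * (1 / 10) ^ q) ≤ (93 / 100) ^ q := by
      rw [← mul_pow, ← mul_pow]
      gcongr
      norm_num
    have h2 : (200 / 79 : ℝ) ^ q * ((3 ^ q)⁻¹ * (11 / 10) ^ q) ≤ (93 / 100) ^ q := by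
      rw [← inv_pow, ← mul_pow, ← mul_pow]
      gcongr
      norm_num
    calc _ ≤ ((8 * K).choose q * (200 / 79) ^ q : ℝ) *
          (3 ^ q * (1 / 10) ^ q + (3 ^ q)⁻¹ * (11 / 10) ^ q) := by
          gcongr
          exact choose_le_choose_mul_pow hK hq
      _ = (8 * K).choose q * ((200 / 79 : ℝ) ^ q * (3 ^ q * (1 / 10) ^ q) +
          (200 / 79 : ℝ) ^ q * ((3 ^ q)⁻¹ * (11 / 10) ^ q)) := by ring
      _ ≤ (8 * K).choose q * ((93 / 100) ^ q + (93 / 100) ^ q) := by gcongr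
      _ = _ := by ring
  have hle : 2 * ((8 * K).choose q : ℝ≥0∞) * X ≤
      2 * ((8 * K).choose q : ℝ≥0∞) * ENNReal.ofReal ((93 / 100) ^ q) := by
    calc _ ≤ _ := hmain
      _ ≤ ((20 * K).choose q : ℝ≥0∞) * (ENNReal.ofReal (3 ^ q) * ENNReal.ofReal (1 / 10) ^ q +
          (ENNReal.ofReal (3 ^ q))⁻¹ * ENNReal.ofReal ((11 / 10) ^ q)) := by gcongr
      _ = ENNReal.ofReal (((20 * K).choose q : ℝ) *
          (3 ^ q * (1 / 10) ^ q + (3 ^ q)⁻¹ * (11 / 10) ^ q)) := by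
          rw [ENNReal.ofReal_mul (by positivity), ENNReal.ofReal_add (by positivity)
            (by positivity), ENNReal.ofReal_mul (by positivity), ENNReal.ofReal_mul (by positivity),
            ENNReal.ofReal_natCast, ENNReal.ofReal_pow (p := 1 / 10) (by positivity),
            ENNReal.ofReal_inv_of_pos ht]
      _ ≤ ENNReal.ofReal (2 * (8 * K).choose q * (93 / 100) ^ q) := ENNReal.ofReal_le_ofReal hreal
      _ = _ := by
          rw [ENNReal.ofReal_mul (by positivity), ENNReal.ofReal_mul (by positivity),
            ENNReal.ofReal_natCast, ENNReal.ofReal_ofNat]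
  refine (ENNReal.mul_le_mul_iff_right ?_ ?_).1 hle
  · simp [hchoose.ne']
  · finiteness

/-- Few copies fail when the mechanism is sufficiently stable. -/
theorem expect_gameValue_stable_le {K M N q : ℕ} (hK : 0 < K) (hq : 10 * q ≤ K)
    (grid : Fin M → ℝ) (α : ℝ) (cap : ℕ) {ε s : ℝ} (hε : 0 ≤ ε) (hs : s ≤ 1 / 4)
    (hs' : Real.exp (2 * (q * ε)) - 1 ≤ s) (hN : 6 * s ^ 2 * N ≤ 9 / 100 * q)
    (adv : Adversary n) (ind : Transcript n → ℝ≥0∞) (bad : Set (Transcript n)) (m : ℕ)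
    (hind : ∀ h, ind h ≤ 1)
    (hf : ∀ h : Transcript n, h.length = m → ind h ≠ 0 →
      (A.run h.stream).expect (bad.indicator 1) ≤ ENNReal.ofReal (1 / 10)) (v : Control M N) :
    (PMF.pi fun _ : Fin (20 * K) => A.start).expect (fun s =>
      gameValue (ensembleStep A.recordStep (updateMechanism grid α cap ε) Control.next
        fun v => grid v.1) adv
        (fun s h => ind h *
          if 8 * K ≤ failCount bad s.1 then 1 else 0)
        m (fun j => (s j, []), v) []) ≤ ENNReal.ofReal ((93 / 100) ^ q) := by
  refine A.expect_gameValue_many_bad_le hK hq _ _ _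
    (fun _ v => ENNReal.ofReal ((1 + 6 * s ^ 2) ^ (N - (v.2 : ℕ)))) (fun r v => ?_) (fun J hJ => ?_)
    adv ind bad m hind hf v ?_
  · rw [ENNReal.one_le_ofReal]
    exact one_le_pow₀ (by nlinarith [sq_nonneg s])
  · refine ⟨updateMechanism grid α cap ε, fun r v a b => ?_⟩
    refine updateMechanism_potential grid α cap ε s hε hs J (by rwa [hJ]) v _ _ fun j hj => ?_
    exact if_neg hj
  · refine ENNReal.ofReal_le_ofReal ?_
    calc (1 + 6 * s ^ 2) ^ (N - (v.2 : ℕ)) ≤ (1 + 6 * s ^ 2) ^ N :=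
          pow_le_pow_right₀ (by nlinarith [sq_nonneg s]) (Nat.sub_le _ _)
      _ ≤ Real.exp (6 * s ^ 2) ^ N := by
          gcongr
          linarith [Real.add_one_le_exp (6 * s ^ 2)]
      _ = Real.exp (N * (6 * s ^ 2)) := (Real.exp_nat_mul _ _).symm
      _ ≤ _ := exp_le_pow q (by linarith)

/-- Few copies fail when there are few possible sequences of outcomes of the mechanism. -/
theorem expect_gameValue_paths_le {K M N q : ℕ} (hK : 0 < K) (hq : 10 * q ≤ K)
    (hM : 0 < M) (grid : Fin M → ℝ) (α : ℝ) (cap : ℕ) {ε : ℝ} {m : ℕ} (hm : 0 < m)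
    (hN : 1 + N * Real.log ((m + 1) * M) ≤ 9 / 100 * q)
    (adv : Adversary n) (ind : Transcript n → ℝ≥0∞) (bad : Set (Transcript n))
    (hind : ∀ h, ind h ≤ 1)
    (hf : ∀ h : Transcript n, h.length = m → ind h ≠ 0 →
      (A.run h.stream).expect (bad.indicator 1) ≤ ENNReal.ofReal (1 / 10)) (v : Control M N) :
    (PMF.pi fun _ : Fin (20 * K) => A.start).expect (fun s =>
      gameValue (ensembleStep A.recordStep (updateMechanism grid α cap ε) Control.next
        fun v => grid v.1) adv
        (fun s h => ind h *
          if 8 * K ≤ failCount bad s.1 then 1 else 0)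
        m (fun j => (s j, []), v) []) ≤ ENNReal.ofReal ((93 / 100) ^ q) := by
  have hmR : (0 : ℝ) < m := by exact_mod_cast hm
  have hMR : (1 : ℝ) ≤ M := by exact_mod_cast hM
  have hbase : ((m + 1) / m : ℝ≥0∞) = ENNReal.ofReal ((m + 1) / m) := by
    rw [ENNReal.ofReal_div_of_pos hmR, ENNReal.ofReal_add (by positivity) zero_le_one]
    simp
  have hbase' : ((m + 1) * M : ℝ≥0∞) = ENNReal.ofReal ((m + 1) * M) := by
    rw [ENNReal.ofReal_mul (by positivity), ENNReal.ofReal_add (by positivity) zero_le_one]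
    simp
  have h1 : (1 : ℝ) ≤ (m + 1) / m := by rw [le_div_iff₀ hmR]; linarith
  have h1' : (1 : ℝ) ≤ (m + 1) * M := by nlinarith
  refine A.expect_gameValue_many_bad_le hK hq _ _ _
    (fun r v => ((m + 1) / m : ℝ≥0∞) ^ r * ((m + 1) * M) ^ (N - (v.2 : ℕ))) (fun r v => ?_)
    (fun J _ => ?_) adv ind bad m hind hf v ?_
  · rw [hbase, hbase']
    exact one_le_mul (one_le_pow₀ (by rwa [ENNReal.one_le_ofReal]))
      (one_le_pow₀ (by rwa [ENNReal.one_le_ofReal]))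
  · exact ⟨fun v _ => if (v.2 : ℕ) < N then guessUpdate m M hM else PMF.pure none,
      fun r v a b => guess_potential (updateMechanism grid α cap ε)
        (fun v z hv => if_neg hv) m hm hM r v _⟩
  · rw [hbase, hbase', ← ENNReal.ofReal_pow (by positivity), ← ENNReal.ofReal_pow (by positivity),
      ← ENNReal.ofReal_mul (by positivity)]
    refine ENNReal.ofReal_le_ofReal ?_
    calc ((m + 1) / m : ℝ) ^ m * ((m + 1) * M) ^ (N - (v.2 : ℕ))
        ≤ Real.exp (1 / m) ^ m * ((m + 1) * M) ^ N := by
          gcongr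
          · rw [add_div, div_self hmR.ne', add_comm]
            exact Real.add_one_le_exp _
          · exact Nat.sub_le _ _
      _ = Real.exp (1 + N * Real.log ((m + 1) * M)) := by
          rw [← Real.exp_nat_mul, mul_one_div_cancel hmR.ne', Real.exp_add, Real.exp_nat_mul _ N,
            Real.exp_log (by linarith)]
      _ ≤ _ := exp_le_pow q hN

end StreamingAlgorithm

/-! ### Choice of parameters -/

theorem clog_le_log {y : ℕ} (hy : 0 < y) : (Nat.clog 2 y : ℝ) ≤ 1 + 3 / 2 * Real.log y := by
  have hy' : (1 : ℝ) ≤ y := by exact_mod_cast hy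
  have hlog : 0 ≤ Real.log y := Real.log_nonneg hy'
  rcases Nat.lt_or_ge (Nat.clog 2 y) 2 with h | h
  · have : (Nat.clog 2 y : ℝ) ≤ 1 := by exact_mod_cast Nat.lt_succ_iff.1 h
    linarith
  · have h1 : 2 ^ (Nat.clog 2 y - 1) < y := by
      by_contra! hcon
      have := Nat.clog_le_of_le_pow hcon
      omega
    have h2 : ((2 : ℝ) ^ (Nat.clog 2 y - 1)) ≤ y := by exact_mod_cast h1.le
    have h3 := Real.log_le_log (by positivity) h2
    rw [Real.log_pow, Nat.cast_sub (by omega), Nat.cast_one] at h3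
    have h4 : (1 : ℝ) ≤ (Nat.clog 2 y : ℝ) - 1 := by
      have : (2 : ℝ) ≤ Nat.clog 2 y := by exact_mod_cast h
      linarith
    nlinarith [Real.log_two_gt_d9]

theorem log_error_le {c m M : ℕ} {α δ : ℝ} (hm : (1 : ℝ) ≤ m) (hα : 0 < α) (hα1 : α ≤ 1)
    (hδ : 0 < δ) (hδ2 : δ ≤ 1 / 2) (hM : (M : ℝ) ≤ 69 * (1 + c ^ 2) * m / α) :
    Real.log (2 * m * (M + 1) / δ) ≤
      (2 + Real.log (140 * (1 + c ^ 2)) / Real.log 2) * Real.log (m / (α * δ)) := by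
  have hM1 : (M + 1 : ℝ) ≤ 70 * (1 + c ^ 2) * m / α := by
    have h1 : 1 ≤ (1 + c ^ 2) * m / α := by
      rw [le_div_iff₀ hα]
      nlinarith [mul_nonneg (sq_nonneg (c : ℝ)) (Nat.cast_nonneg (α := ℝ) m)]
    calc (M + 1 : ℝ) ≤ 69 * (1 + c ^ 2) * m / α + (1 + c ^ 2) * m / α := add_le_add hM h1
      _ = _ := by ring
  have hαδ : α * δ ≤ 1 / 2 := by nlinarith
  have hle : 2 * m * (M + 1) / δ ≤ 140 * (1 + c ^ 2) * (m / (α * δ)) ^ 2 := by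
    calc 2 * m * (M + 1) / δ ≤ 2 * m * (70 * (1 + c ^ 2) * m / α) / δ := by gcongr
      _ = 140 * (1 + c ^ 2) * (m * (m / (α * δ))) := by field_simp; ring
      _ ≤ 140 * (1 + c ^ 2) * ((m / (α * δ)) * (m / (α * δ))) := by
        gcongr
        rw [le_div_iff₀ (by positivity)]
        nlinarith
      _ = _ := by ring
  have hlog : Real.log 2 ≤ Real.log (m / (α * δ)) :=
    Real.log_le_log two_pos (by rw [le_div_iff₀ (by positivity)]; linarith)
  have hC : 0 ≤ Real.log (140 * (1 + (c : ℝ) ^ 2)) :=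
    Real.log_nonneg (by nlinarith [sq_nonneg (c : ℝ)])
  have hlog2 : 0 < Real.log 2 := Real.log_pos one_lt_two
  have hpos : 0 < m / (α * δ) := by positivity
  calc Real.log (2 * m * (M + 1) / δ) ≤ Real.log (140 * (1 + c ^ 2) * (m / (α * δ)) ^ 2) :=
        Real.log_le_log (by positivity) hle
    _ = Real.log (140 * (1 + c ^ 2)) + 2 * Real.log (m / (α * δ)) := by
        rw [Real.log_mul (by positivity) (by positivity), Real.log_pow]
        norm_num
    _ ≤ Real.log (140 * (1 + c ^ 2)) / Real.log 2 * Real.log (m / (α * δ)) +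
        2 * Real.log (m / (α * δ)) := by
        gcongr
        rw [div_mul_eq_mul_div, le_div_iff₀ hlog2]
        exact mul_le_mul_of_nonneg_left hlog hC
    _ = _ := by ring

theorem clog_control_le {m M lam : ℕ} {δ E : ℝ} (hm : 1 ≤ m) (hM : 0 < M) (hlam : lam ≤ m)
    (hδ : 0 < δ) (hδ2 : δ ≤ 1 / 2) (hE : Real.log (2 * m * (M + 1) / δ) ≤ E) :
    (Nat.clog 2 (M * (lam + 2 + 1)) : ℝ) ≤ 5 / 2 + 3 / 2 * E := by
  have hpos : 0 < M * (lam + 2 + 1) := by positivity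
  have hm0 : (0 : ℝ) < m := by exact_mod_cast hm
  have hle : ((M * (lam + 2 + 1) : ℕ) : ℝ) ≤ 2 * (2 * m * (M + 1) / δ) := by
    calc ((M * (lam + 2 + 1) : ℕ) : ℝ) ≤ M * (4 * m) := by
          have : lam + 2 + 1 ≤ 4 * m := by omega
          exact_mod_cast Nat.mul_le_mul_left M this
      _ ≤ 2 * (2 * m * (M + 1)) := by nlinarith
      _ ≤ 2 * (2 * m * (M + 1) / δ) := by
          gcongr
          exact le_div_self (by positivity) hδ (by linarith)
  have hlog := Real.log_le_log (by exact_mod_cast hpos) hle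
  rw [Real.log_mul (by norm_num) (by positivity)] at hlog
  have := clog_le_log hpos
  linarith [Real.log_two_lt_d9]

/-- The choice of parameters when the flip number is large. -/
theorem exists_stable_parameters {Λ l D C₂ x ε : ℝ} {K N : ℕ} (hl : 69 / 100 ≤ l) (hlD : l ≤ D)
    (hΛ : l ≤ Λ) (hC₂ : 2 ≤ C₂) (hx0 : 0 ≤ x) (hx : x * x = Λ * l) (hN : (N : ℝ) ≤ 3 * Λ)
    (hK : 640 * C₂ * (x * D) ≤ K) (hε0 : 0 ≤ ε) (hε : ε * K = C₂ * D) :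
    ∃ (q : ℕ) (s : ℝ), 10 * q ≤ K ∧ 30 * l ≤ q ∧ s ≤ 1 / 4 ∧ Real.exp (2 * (q * ε)) - 1 ≤ s ∧
      6 * s ^ 2 * N ≤ 9 / 100 * q := by
  have hlx : l ≤ x := by nlinarith
  have hD : 0 < D := by linarith
  -- This is the source of the square root: `ε` is about `1 / √(Λ l)`, so `Λ` changes cost `Λ * (l *
  -- ε) ^ 2`, which is of order `l`, as is `q`.
  have hεx : ε * x ≤ 1 / 640 := by
    have h1 : ε * (640 * C₂ * (x * D)) ≤ C₂ * D := hε ▸ mul_le_mul_of_nonneg_left hK hε0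
    have h2 : 0 < C₂ * D := by positivity
    have h3 : (C₂ * D) * (640 * (ε * x)) ≤ (C₂ * D) * 1 := by linarith
    linarith [le_of_mul_le_mul_left h3 h2]
  have hq1 : 30 * l ≤ (⌈30 * l⌉₊ : ℝ) := Nat.le_ceil _
  have hq2 : (⌈30 * l⌉₊ : ℝ) ≤ 32 * l := by
    have := (Nat.ceil_lt_add_one (show 0 ≤ 30 * l by linarith)).le
    linarith
  set q := ⌈30 * l⌉₊
  have hqε : (q : ℝ) * ε ≤ 32 * (l * ε) := by nlinarith
  have hlε : l * ε ≤ 1 / 640 := by nlinarith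
  have hlε0 : 0 ≤ l * ε := mul_nonneg (by linarith) hε0
  -- Here `2 * q * ε ≤ 64 * (l * ε)`, and `exp y - 1 ≤ 2 * y` on `[0, 1]`.
  refine ⟨q, 128 * (l * ε), ?_, hq1, by linarith, ?_, ?_⟩
  · have h1 : (10 : ℝ) * q ≤ K := by
      have h2 : l * (69 / 100) ≤ x * D := mul_le_mul hlx (by linarith) (by norm_num) hx0
      nlinarith
    exact_mod_cast h1
  · have h0 : 0 ≤ 2 * ((q : ℝ) * ε) := by positivity
    have h1 : 2 * ((q : ℝ) * ε) ≤ 64 * (l * ε) := by linarith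
    have h2 := Real.abs_exp_sub_one_sub_id_le (x := 2 * ((q : ℝ) * ε))
      (by rw [abs_of_nonneg h0]; linarith)
    have h3 := (abs_le.1 h2).2
    nlinarith
  · have h1 : (l * ε) ^ 2 * Λ = l * (ε * x) ^ 2 := by
      linear_combination (-(l * ε ^ 2)) * hx
    have h2 : (ε * x) ^ 2 ≤ (1 / 640) ^ 2 := pow_le_pow_left₀ (mul_nonneg hε0 hx0) hεx 2
    have h3 : 6 * (128 * (l * ε)) ^ 2 * N ≤ 6 * (128 * (l * ε)) ^ 2 * (3 * Λ) := by gcongr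
    have h4 : l * (ε * x) ^ 2 ≤ l * (1 / 640) ^ 2 :=
      mul_le_mul_of_nonneg_left h2 (by linarith)
    linarith

/-- The choice of parameters when the flip number is small. -/
theorem exists_paths_parameters {Λ l D C₂ x y : ℝ} {K N : ℕ} (hl : 69 / 100 ≤ l) (hlD : l ≤ D)
    (hΛ1 : 1 ≤ Λ) (hΛ : Λ ≤ l) (hC₂ : 2 ≤ C₂) (hx0 : 0 ≤ x) (hx : x * x = Λ * l)
    (hN : (N : ℝ) ≤ 3 * Λ) (hK : 640 * C₂ * (x * D) ≤ K) (hy : y ≤ C₂ * D) (hy0 : 0 ≤ y) :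
    ∃ q : ℕ, 10 * q ≤ K ∧ 30 * l ≤ q ∧ 1 + N * y ≤ 9 / 100 * q := by
  have hΛx : Λ ≤ x := by nlinarith
  have hx1 : 1 ≤ x := hΛ1.trans hΛx
  have hD : 0 < D := by linarith
  have hlxD : l ≤ x * D := by nlinarith
  have hq : (K : ℝ) / 10 - 1 ≤ (K / 10 : ℕ) := by
    have h1 : K ≤ 10 * (K / 10) + 9 := by omega
    have h2 : (K : ℝ) ≤ 10 * (K / 10 : ℕ) + 9 := by exact_mod_cast h1
    linarith
  have hxD : 69 / 100 ≤ x * D := hl.trans hlxD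
  have hC : 2 * (x * D) ≤ C₂ * (x * D) := mul_le_mul_of_nonneg_right hC₂ (by linarith)
  -- Stability is not used here, so `q` can be as large as `10 * q ≤ K` permits; it must pay for `N
  -- * y`, which is of order `x * D` because `Λ ≤ x`.
  refine ⟨K / 10, by omega, by nlinarith, ?_⟩
  have h1 : (N : ℝ) * y ≤ 3 * (C₂ * (x * D)) := by
    calc (N : ℝ) * y ≤ (3 * x) * (C₂ * D) := mul_le_mul (by linarith) hy hy0 (by linarith)
      _ = _ := by ring
  linarith

/-- The probability that many copies of an obliviously accurate algorithm fail. -/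
theorem StreamingAlgorithm.ObliviouslyAccurate.expect_gameValue_badCount_le {n m K M N : ℕ}
    {A : StreamingAlgorithm n} {g : UpdateStream n → ℝ} {𝒮 : Set (UpdateStream n)}
    {α δ Λ D C₂ x ε : ℝ} (hA : A.ObliviouslyAccurate g 𝒮 m (α / 10) (9 / 10)) (hδ : 0 < δ)
    (hδ2 : δ ≤ 1 / 2) (hlD : Real.log (1 / δ) ≤ D) (hΛ1 : 1 ≤ Λ) (hC₂ : 2 ≤ C₂) (hx0 : 0 ≤ x)
    (hx : x * x = Λ * Real.log (1 / δ)) (hN : (N : ℝ) ≤ 3 * Λ) (hK0 : 0 < K)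
    (hK : 640 * C₂ * (x * D) ≤ K) (hε0 : 0 ≤ ε) (hε : ε * K = C₂ * D) (hM : 0 < M) (hm : 0 < m)
    (hE : Real.log (2 * m * (M + 1) / δ) ≤ C₂ * D) (grid : Fin M → ℝ) (adv : Adversary n)
    (v : Control M N) :
    (PMF.pi fun _ : Fin (20 * K) => A.start).expect (fun s =>
      gameValue (ensembleStep A.recordStep (updateMechanism grid α (10 * K) ε) Control.next
        fun v => grid v.1) adv
        (fun s h => {h : Transcript n | h.stream ∈ 𝒮}.indicator 1 h *
          if 8 * K ≤ badCount g α s.1 then 1 else 0)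
        m (fun j => (s j, []), v) []) ≤ ENNReal.ofReal (δ / 2) := by
  have hind : ∀ h : Transcript n,
      {h : Transcript n | h.stream ∈ 𝒮}.indicator (1 : Transcript n → ℝ≥0∞) h ≤ 1 :=
    fun h => Set.indicator_le_self' (by simp) h
  have hf : ∀ h : Transcript n, h.length = m →
      {h : Transcript n | h.stream ∈ 𝒮}.indicator (1 : Transcript n → ℝ≥0∞) h ≠ 0 →
      (A.run h.stream).expect ({h | ¬ h.Accurate g (α / 10)}.indicator 1) ≤
        ENNReal.ofReal (1 / 10) := fun h hlen hne =>
    hA.expect_le (Set.mem_of_indicator_ne_zero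
      (s := {h : Transcript n | h.stream ∈ 𝒮}) hne) (by rw [Transcript.length_stream, hlen])
  have hl0 : 69 / 100 ≤ Real.log (1 / δ) := by
    have := Real.log_le_log two_pos (show 2 ≤ 1 / δ by rw [le_div_iff₀ hδ]; linarith)
    linarith [Real.log_two_gt_d9]
  rcases le_total (Real.log (1 / δ)) Λ with hcase | hcase
  · obtain ⟨q, s, hq, hql, hs, hs', hNs⟩ :=
      exists_stable_parameters hl0 hlD hcase hC₂ hx0 hx hN hK hε0 hε
    exact (A.expect_gameValue_stable_le hK0 hq grid α (10 * K) hε0 hs hs' hNs adv _ _ m hind hf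
      v).trans (ENNReal.ofReal_le_ofReal (pow_le_half_of_log_le hδ hδ2 hql))
  · have hmR : (0 : ℝ) < m := by exact_mod_cast hm
    have hMR : (1 : ℝ) ≤ M := by exact_mod_cast hM
    have hmM : (1 : ℝ) ≤ (m + 1) * M := by nlinarith
    have hy : Real.log ((m + 1) * M) ≤ C₂ * D := by
      refine (Real.log_le_log (by linarith) ?_).trans hE
      have hm1 : (1 : ℝ) ≤ m := by exact_mod_cast hm
      calc ((m : ℝ) + 1) * M ≤ (2 * m) * (M + 1) := by gcongr <;> linarith
        _ ≤ _ := le_div_self (by positivity) hδ (by linarith)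
    obtain ⟨q, hq, hql, hNq⟩ := exists_paths_parameters hl0 hlD hΛ1 hcase hC₂ hx0 hx hN
      hK hy (Real.log_nonneg hmM)
    exact (A.expect_gameValue_paths_le hK0 hq hM grid α (10 * K) hm hNq adv _ _ hind hf
      v).trans (ENNReal.ofReal_le_ofReal (pow_le_half_of_log_le hδ hδ2 hql))

theorem mainTheorem1 (c : ℕ) :
    ∃ C : ℝ, 0 < C ∧
      ∀ (n m : ℕ), 1 ≤ m → Real.log n ≤ c * Real.log m →
      ∀ (g : UpdateStream n → ℝ) (𝒮 : Set (UpdateStream n)) (α δ : ℝ),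
        0 < α → α ≤ 1 → 0 < δ → δ ≤ 1 / 2 →
      ∀ (A : StreamingAlgorithm n) (L : ℕ), 1 ≤ L → A.space ≤ L →
        A.EstimatesPolyBounded 𝒮 m c →
        A.ObliviouslyAccurate g 𝒮 m (α / 10) (9 / 10) →
        ∃ B : StreamingAlgorithm n,
          B.AdversariallyRobust g 𝒮 m α (1 - δ) ∧
          (B.space : ℝ) ≤
            C * (L * Real.sqrt (max 1 (flipNumber g 𝒮 (α / 10) m : ℝ) * Real.log (1 / δ)) *
              Real.log (m / (α * δ))) := by
  set C₁ : ℝ := 140 * (1 + c ^ 2) with hC₁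
  have hC₁1 : 1 ≤ C₁ := by
    rw [hC₁]
    nlinarith [sq_nonneg (c : ℝ)]
  have hlog2 := Real.log_two_gt_d9
  set C₂ : ℝ := 2 + Real.log C₁ / Real.log 2 with hC₂
  have hC₂2 : 2 ≤ C₂ := by
    have := div_nonneg (Real.log_nonneg hC₁1) (Real.log_nonneg one_le_two)
    linarith
  refine ⟨20000 * C₂, by positivity, ?_⟩
  intro n m hm hnm g 𝒮 α δ hα hα1 hδ hδ2 A L hL hspace hpoly hobl
  obtain ⟨M, hM, hMle, grid, hgrid⟩ := hobl.exists_grid hm hnm hα hα1 hpoly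
  have hmR : (1 : ℝ) ≤ m := by exact_mod_cast hm
  have hMR : (1 : ℝ) ≤ M := by exact_mod_cast hM
  have hLR : (1 : ℝ) ≤ L := by exact_mod_cast hL
  set lam := flipNumber g 𝒮 (α / 10) m with hlam
  have hlamm : lam ≤ m := flipNumber_le _ _ _ _
  set Λ : ℝ := max 1 (lam : ℝ) with hΛ
  have hΛ1 : 1 ≤ Λ := le_max_left _ _
  have hΛlam : (lam : ℝ) ≤ Λ := le_max_right _ _
  set l := Real.log (1 / δ) with hl
  have hl2 : Real.log 2 ≤ l :=
    Real.log_le_log two_pos (by rw [le_div_iff₀ hδ]; linarith)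
  set D := Real.log (m / (α * δ)) with hD
  have hlD : l ≤ D := by
    refine Real.log_le_log (by positivity) ?_
    rw [div_le_div_iff₀ hδ (by positivity)]
    nlinarith [mul_nonneg (sub_nonneg.2 hα1) hδ.le, mul_nonneg (sub_nonneg.2 hmR) hδ.le]
  have hl0 : 69 / 100 ≤ l := by linarith
  have hE : Real.log (2 * m * (M + 1) / δ) ≤ C₂ * D :=
    log_error_le hmR hα hα1 hδ hδ2 hMle
  set x := Real.sqrt (Λ * l) with hxdef
  have hx0 : 0 ≤ x := Real.sqrt_nonneg _
  have hx : x * x = Λ * l := Real.mul_self_sqrt (by positivity)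
  have hx8 : 8 / 10 ≤ x := by nlinarith
  have hxD0 : 55 / 100 ≤ x * D := by nlinarith
  have hDx : D ≤ 5 / 4 * (x * D) := by nlinarith
  set K := ⌈640 * C₂ * (x * D)⌉₊ with hKdef
  have hK1 : 640 * C₂ * (x * D) ≤ K := Nat.le_ceil _
  have hK2 : (K : ℝ) ≤ 640 * C₂ * (x * D) + 1 := (Nat.ceil_lt_add_one (by positivity)).le
  have hKR : (0 : ℝ) < K := lt_of_lt_of_le (by positivity) hK1
  have hK : 0 < K := by exact_mod_cast hKR
  set ε := C₂ * D / K with hεdef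
  have hεK : ε * K = C₂ * D := div_mul_cancel₀ _ hKR.ne'
  have hε : 0 < ε := div_pos (mul_pos (by linarith) (by linarith)) hKR
  have hN : ((lam + 2 : ℕ) : ℝ) ≤ 3 * Λ := by
    push_cast
    linarith
  -- The initial grid index is arbitrary: no estimate is published before the first round, and the
  -- first change need not be a flip.
  refine ⟨A.robust (N := lam + 2) K grid α ε (⟨0, hM⟩, 0), ?_, ?_⟩
  · refine A.robust_adversariallyRobust hα.le hα1 hε le_rfl hgrid _ rfl hδ.le (fun adv =>
      hobl.expect_gameValue_badCount_le hδ hδ2 hlD hΛ1 hC₂2 hx0 hx hN hK hK1 hε.le hεK hM hm hE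
        grid adv _) ?_
    · rw [hεK]
      have h1 : Real.exp (-(C₂ * D)) ≤ δ / (2 * m * (M + 1)) := by
        calc Real.exp (-(C₂ * D)) ≤ Real.exp (-Real.log (2 * m * (M + 1) / δ)) :=
              Real.exp_le_exp.2 (neg_le_neg hE)
          _ = _ := by
              rw [Real.exp_neg, Real.exp_log (by positivity), inv_div]
      calc m * ((M + 1) * Real.exp (-(C₂ * D))) ≤ m * ((M + 1) * (δ / (2 * m * (M + 1)))) := by
            gcongr
        _ = δ / 2 := by field_simp
  · have h1 : ((A.robust (N := lam + 2) K grid α ε (⟨0, hM⟩, 0)).space : ℝ) ≤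
        20 * K * L + Nat.clog 2 (M * (lam + 2 + 1)) := by
      exact_mod_cast (A.space_robust_le grid α ε _).trans
        (Nat.add_le_add_right (Nat.mul_le_mul_left _ hspace) _)
    -- The control state needs only `O(C₂ * D)` bits, which the space of the copies dominates
    -- because `x` is bounded below.
    have h2 := clog_control_le hm hM hlamm hδ hδ2 hE
    have h5 : C₂ * D ≤ 5 / 4 * (C₂ * (x * D)) := by
      have := mul_le_mul_of_nonneg_left hDx (show 0 ≤ C₂ by linarith)
      linarith
    have h6 : 2 * (x * D) ≤ C₂ * (x * D) := mul_le_mul_of_nonneg_right hC₂2 (by linarith)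
    set X := C₂ * (x * D) with hX
    have h7 : X ≤ L * X := le_mul_of_one_le_left (by linarith) hLR
    have h8 : (20 * K * L : ℝ) ≤ 20 * (640 * X + X) * L := by
      gcongr
      rw [hX]
      linarith
    have h9 : 20000 * C₂ * (L * x * D) = 20000 * (L * X) := by rw [hX]; ring
    rw [h9]
    linarith
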